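/- Let $R$ and $S$ be associative rings with unit and let ${}_R\omega_S$ be a semidualizing $(R,S)$-bimodule, i.e. (a) ${}_R\omega$ and $\omega_S$ each admit a resolution by finitely generated projective $R$-modules, respectively $S^{op}$-modules; (b) the homothety maps $R\to\mathrm{Hom}_{S^{op}}(\omega,\omega)$ and $S\to\mathrm{Hom}_R(\omega,\omega)$ are isomorphisms; (c) $\mathrm{Ext}_R^{i}(\omega,\omega)=0=\mathrm{Ext}^{i}_{S^{op}}(\omega,\omega)$ for all $i\ge 1$. Write $M_*=\mathrm{Hom}_R(\omega,M)$ for a left $R$-module $M$. Let $\mathcal F_\omega(R)$ (resp. $\mathcal P_\omega(R)$) be the class of left $R$-modules isomorphic to $\omega\otimes_S F$ with $F$ a flat (resp. projective) left $S$-module, and let $\mathcal I_\omega(S)$ be the class of left $S$-modules isomorphic to $\mathrm{Hom}_R(\omega,I)$ with $I$ an injective left $R$-module. For a class $\mathcal X$ of modules, $\mathcal X\text{-}\mathrm{pd}\,M$ is the infimum of the integers $n\ge 0$ for which there is an exact sequence $0\to X_n\to\cdots\to X_0\to M\to 0$ with all $X_i\in\mathcal X$, and $\mathcal X\text{-}\mathrm{id}\,M$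 is the infimum of the integers $n\ge0$ for which there is an exact sequence $0\to M\to X^0\to\cdots\to X^n\to 0$ with all $X^i\in\mathcal X$ (both are $\infty$ if there is no such $n$). The flat, projective and injective dimensions $\mathrm{fd}$, $\mathrm{pd}$, $\mathrm{id}$ are the usual ones; the zero module has dimension $0$. A left $R$-module $M$ with minimal injective resolution $0\to M\to I^0\xrightarrow{f^0}I^1\to\cdots$ is $\infty$-$\omega$-cotorsionfree if $\mathrm{Tor}_i^S(\omega,\mathrm{Coker}(f^0_*))=0$ for all $i\ge1$, where $f^0_*=\mathrm{Hom}_R(\omega,f^0)$. The Auslander class $\mathcal A_\omega(S)$ consists of the left $S$-modules $N$ such that $\mathrm{Tor}_i^S(\omega,N)=0$ and $\mathrm{Ext}_R^i(\omega,\omega\otimes_SN)=0$ for all $i\ge1$ and the map $\mu_N:N\to(\omega\otimes_SN)_*$, $\mu_N(y)(x)=x\otimes y$, is an isomorphism. Then: 1. For every left $R$-module $M$, $\mathrm{fd}_S M_*\le\mathcal F_\omega(R)\text{-}\mathrm{pd}_R M$, with equality if $M$ is $\infty$-$\omega$-cotorsionfree. 2. For every left $R$-module $M$, $\mathrm{pd}_S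 M_*\le\mathcal P_\omega(R)\text{-}\mathrm{pd}_R M$, with equality if $M$ is $\infty$-$\omega$-cotorsionfree. 3. For every left $S$-module $N$, $\mathrm{id}_R(\omega\otimes_S N)\le\mathcal I_\omega(S)\text{-}\mathrm{id}_S N$, with equality if $N\in\mathcal A_\omega(S)$. -/

import Mathlib

universe u

open CategoryTheory TensorProduct

noncomputable section

namespace SemiDual

/-! ### Tensor product over a noncommutative ring

A right `S`-module is a module over `Sᵐᵒᵖ`, with `x s = MulOpposite.op s • x`. -/

section Tensor

variable (S : Type u) [Ring S]

/-- The relations `(x s) ⊗ n = x ⊗ (s n)`. -/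
def balancedRel (A N : Type u) [AddCommGroup A] [Module Sᵐᵒᵖ A] [AddCommGroup N] [Module S N] :
    Submodule ℤ (A ⊗[ℤ] N) :=
  Submodule.span ℤ {t | ∃ (x : A) (s : S) (n : N),
    t = (MulOpposite.op s • x) ⊗ₜ[ℤ] n - x ⊗ₜ[ℤ] (s • n)}

/-- The tensor product `A ⊗_S N` of a right `S`-module `A` and a left `S`-module `N`. -/
def BTensor (A N : Type u) [AddCommGroup A] [Module Sᵐᵒᵖ A] [AddCommGroup N] [Module S N] :
    Type u :=
  (A ⊗[ℤ] N) ⧸ balancedRel S A N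

namespace BTensor

instance instAddCommGroup (A N : Type u) [AddCommGroup A] [Module Sᵐᵒᵖ A] [AddCommGroup N]
    [Module S N] : AddCommGroup (BTensor S A N) :=
  inferInstanceAs (AddCommGroup ((A ⊗[ℤ] N) ⧸ balancedRel S A N))

variable {A B N N' : Type u} [AddCommGroup A] [Module Sᵐᵒᵖ A] [AddCommGroup B] [Module Sᵐᵒᵖ B]
  [AddCommGroup N] [Module S N] [AddCommGroup N'] [Module S N']

/-- The quotient map `A ⊗_ℤ N → A ⊗_S N`. -/
def mk : A ⊗[ℤ] N →+ BTensor S A N :=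
  (balancedRel S A N).mkQ.toAddMonoidHom

theorem mk_surjective : Function.Surjective (mk S : A ⊗[ℤ] N →+ BTensor S A N) :=
  (balancedRel S A N).mkQ_surjective

/-- The class of `x ⊗ n` in `A ⊗_S N`. -/
def tmul (x : A) (n : N) : BTensor S A N :=
  mk S (x ⊗ₜ[ℤ] n)

theorem tmul_add (x : A) (n n' : N) : tmul S x (n + n') = tmul S x n + tmul S x n' := by
  simp only [tmul, TensorProduct.tmul_add, map_add]

theorem add_tmul (x x' : A) (n : N) : tmul S (x + x') n = tmul S x n + tmul S x' n := by
  simp only [tmul, TensorProduct.add_tmul, map_add]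

theorem smul_tmul (x : A) (s : S) (n : N) :
    tmul S (MulOpposite.op s • x) n = tmul S x (s • n) :=
  (Submodule.Quotient.eq _).2 (Submodule.subset_span ⟨x, s, n, rfl⟩)

/-- The homomorphism on `A ⊗_S N` induced by a biadditive balanced map. -/
def lift {G : Type u} [AddCommGroup G] (b : A →+ N →+ G)
    (hb : ∀ (x : A) (s : S) (n : N), b (MulOpposite.op s • x) n = b x (s • n)) :
    BTensor S A N →+ G :=
  ((balancedRel S A N).liftQ
    (TensorProduct.liftAddHom b (fun r x n => by simp)).toIntLinearMap (by
      refine Submodule.span_le.2 ?_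
      rintro _ ⟨x, s, n, rfl⟩
      simp [hb])).toAddMonoidHom

@[simp] theorem lift_tmul {G : Type u} [AddCommGroup G] (b : A →+ N →+ G)
    (hb : ∀ (x : A) (s : S) (n : N), b (MulOpposite.op s • x) n = b x (s • n)) (x : A) (n : N) :
    lift S b hb (tmul S x n) = b x n :=
  rfl

@[elab_as_elim]
theorem induction_on {p : BTensor S A N → Prop} (t : BTensor S A N)
    (zero : p 0) (tmul : ∀ x n, p (tmul S x n)) (add : ∀ t t', p t → p t' → p (t + t')) :
    p t := by
  obtain ⟨z, rfl⟩ := mk_surjective S t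
  induction z using TensorProduct.induction_on with
  | zero => rw [map_zero]; exact zero
  | tmul x n => exact tmul x n
  | add z z' h h' =>
    rw [map_add]
    exact add _ _ h h'

theorem hom_ext {G : Type u} [AddCommGroup G] {f g : BTensor S A N →+ G}
    (h : ∀ x n, f (tmul S x n) = g (tmul S x n)) : f = g := by
  ext t
  induction t using induction_on with
  | zero => simp
  | tmul x n => exact h x n
  | add t t' h h' => rw [map_add, map_add, h, h']

/-- `f ⊗ N : A ⊗_S N → B ⊗_S N` for a homomorphism `f : A → B` of right `S`-modules. -/
def rTensor (N : Type u) [AddCommGroup N] [Module S N] (f : A →ₗ[Sᵐᵒᵖ] B) :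
    BTensor S A N →+ BTensor S B N :=
  lift S
    (AddMonoidHom.mk' (fun x => AddMonoidHom.mk' (fun n => tmul S (f x) n)
      (fun n n' => tmul_add S (f x) n n'))
      (fun x x' => by ext n; simp [add_tmul]))
    (fun x s n => by simp [smul_tmul])

@[simp] theorem rTensor_tmul (f : A →ₗ[Sᵐᵒᵖ] B) (x : A) (n : N) :
    rTensor S N f (tmul S x n) = tmul S (f x) n := by
  simp [rTensor]

section Left

variable (R : Type u) [Ring R] [Module R A] [SMulCommClass R Sᵐᵒᵖ A]

/-- If `A` is an `(R,S)`-bimodule, `A ⊗_S N` is a left `R`-module via `r (x ⊗ n) = (r x) ⊗ n`. -/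
instance instModule : Module R (BTensor S A N) where
  smul r t := rTensor S N (Module.toModuleEnd Sᵐᵒᵖ A r) t
  one_smul t := DFunLike.congr_fun (f := rTensor S N (Module.toModuleEnd Sᵐᵒᵖ A (1 : R)))
    (g := AddMonoidHom.id _) (hom_ext S fun x n => by simp) t
  mul_smul r r' t := DFunLike.congr_fun
    (f := rTensor S N (Module.toModuleEnd Sᵐᵒᵖ A (r * r')))
    (g := (rTensor S N (Module.toModuleEnd Sᵐᵒᵖ A r)).comp
      (rTensor S N (Module.toModuleEnd Sᵐᵒᵖ A r')))
    (hom_ext S fun x n => by simp [mul_smul]) t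
  smul_zero r := map_zero _
  smul_add r t t' := map_add _ t t'
  add_smul r r' t := DFunLike.congr_fun
    (f := rTensor S N (Module.toModuleEnd Sᵐᵒᵖ A (r + r')))
    (g := rTensor S N (Module.toModuleEnd Sᵐᵒᵖ A r) + rTensor S N (Module.toModuleEnd Sᵐᵒᵖ A r'))
    (hom_ext S fun x n => by simp [add_smul, add_tmul]) t
  zero_smul t := DFunLike.congr_fun
    (f := rTensor S N (Module.toModuleEnd Sᵐᵒᵖ A (0 : R))) (g := 0)
    (hom_ext S fun x n => by
      have h := add_tmul S (0 : A) 0 n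
      simpa using h) t

@[simp] theorem smul_tmul_left (r : R) (x : A) (n : N) :
    r • tmul S x n = tmul S (r • x) n :=
  (rTensor_tmul S _ x n).trans (by simp)

variable (A) in
/-- `A ⊗ g : A ⊗_S N → A ⊗_S N'`, as an `R`-linear map, for `g : N → N'`. -/
def lTensor (g : N →ₗ[S] N') : BTensor S A N →ₗ[R] BTensor S A N' :=
  let φ : BTensor S A N →+ BTensor S A N' := lift S
    (AddMonoidHom.mk' (fun x => AddMonoidHom.mk' (fun n => tmul S x (g n))
      (fun n n' => by simp [tmul_add]))
      (fun x x' => by ext n; simp [add_tmul]))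
    (fun x s n => by simp [smul_tmul])
  { toFun := φ
    map_add' := map_add φ
    map_smul' := fun r t => by
      induction t using induction_on with
      | zero => simp
      | tmul x n => simp [φ]
      | add t t' h h' => rw [smul_add, map_add, map_add, smul_add, h, h'] }

@[simp] theorem lTensor_tmul (g : N →ₗ[S] N') (x : A) (n : N) :
    lTensor S A R g (tmul S x n) = tmul S x (g n) :=
  rfl

theorem linearMap_ext {G : Type u} [AddCommGroup G] [Module R G] {f g : BTensor S A N →ₗ[R] G}
    (h : ∀ x n, f (tmul S x n) = g (tmul S x n)) : f = g :=
  LinearMap.toAddMonoidHom_injective (hom_ext S h)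

end Left

end BTensor

/-- A left `S`-module `F` is flat if `- ⊗_S F` preserves injections of right `S`-modules. -/
def IsFlat (F : Type u) [AddCommGroup F] [Module S F] : Prop :=
  ∀ (A B : Type u) [AddCommGroup A] [Module Sᵐᵒᵖ A] [AddCommGroup B] [Module Sᵐᵒᵖ B]
    (f : A →ₗ[Sᵐᵒᵖ] B), Function.Injective f → Function.Injective (BTensor.rTensor S F f)

end Tensor

/-! ### Functors attached to an `(R,S)`-bimodule `ω` -/

section Bimodule

variable (R S : Type u) [Ring R] [Ring S] (ω : Type u) [AddCommGroup ω] [Module R ω]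
  [Module Sᵐᵒᵖ ω] [SMulCommClass R Sᵐᵒᵖ ω]

/-- The functor `ω ⊗_S -` from left `S`-modules to left `R`-modules. -/
def tensorFunctor : ModuleCat.{u} S ⥤ ModuleCat.{u} R where
  obj N := ModuleCat.of R (BTensor S ω N)
  map g := ModuleCat.ofHom (BTensor.lTensor S ω R g.hom)
  map_id N := ModuleCat.hom_ext (BTensor.linearMap_ext S R fun x n => by simp)
  map_comp f g := ModuleCat.hom_ext (BTensor.linearMap_ext S R fun x n => by simp)

instance tensorFunctor_additive : (tensorFunctor R S ω).Additive where
  map_add := ModuleCat.hom_ext (BTensor.linearMap_ext S R fun x _ =>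
    BTensor.tmul_add S x _ _)

/-- `Tor_i^S(ω, N)`, the `i`-th left derived functor of `ω ⊗_S -`. -/
def tor (i : ℕ) (N : ModuleCat.{u} S) : ModuleCat.{u} R :=
  ((tensorFunctor R S ω).leftDerived i).obj N

/-- Right multiplication `x ↦ x s` on `ω`, an `R`-linear map. -/
def rightMul (s : S) : ω →ₗ[R] ω where
  toFun x := MulOpposite.op s • x
  map_add' := smul_add _
  map_smul' r x := (smul_comm r (MulOpposite.op s) x).symm

/-- `M_* = Hom_R(ω, M)`, to be regarded as a left `S`-module. -/
def HomFrom (R _S : Type u) [Ring R] (ω : Type u) [AddCommGroup ω] [Module R ω]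
    (M : Type u) [AddCommGroup M] [Module R M] : Type u :=
  ω →ₗ[R] M

namespace HomFrom

variable (M M' : Type u) [AddCommGroup M] [Module R M] [AddCommGroup M'] [Module R M']

instance instAddCommGroup : AddCommGroup (HomFrom R S ω M) :=
  inferInstanceAs (AddCommGroup (ω →ₗ[R] M))

/-- The left `S`-module structure `(s f)(x) = f (x s)` on `Hom_R(ω, M)`. -/
instance instModule : Module S (HomFrom R S ω M) where
  smul s f := LinearMap.comp (show ω →ₗ[R] M from f) (rightMul R S ω s)
  one_smul f := LinearMap.ext fun x => congrArg (show ω →ₗ[R] M from f) (one_smul Sᵐᵒᵖ x)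
  mul_smul s s' f := LinearMap.ext fun x =>
    congrArg (show ω →ₗ[R] M from f) (mul_smul (MulOpposite.op s') (MulOpposite.op s) x)
  smul_zero _ := LinearMap.zero_comp _
  smul_add _ _ _ := LinearMap.add_comp _ _ _
  add_smul s s' f := LinearMap.ext fun x =>
    (congrArg (show ω →ₗ[R] M from f)
      (add_smul (MulOpposite.op s) (MulOpposite.op s') x)).trans
      (map_add (show ω →ₗ[R] M from f) _ _)
  zero_smul f := LinearMap.ext fun x =>
    (congrArg (show ω →ₗ[R] M from f) (zero_smul Sᵐᵒᵖ x)).trans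
      (map_zero (show ω →ₗ[R] M from f))

variable {M M'}

/-- `f_* : Hom_R(ω, M) → Hom_R(ω, M')` for `f : M → M'`. -/
def map (f : M →ₗ[R] M') : HomFrom R S ω M →ₗ[S] HomFrom R S ω M' where
  toFun g := f.comp (show ω →ₗ[R] M from g)
  map_add' _ _ := LinearMap.comp_add _ _ _
  map_smul' _ _ := rfl

end HomFrom

/-- `y ↦ (x ↦ x ⊗ y)`, with values in the `R`-linear maps `ω → ω ⊗_S N`. -/
def tmulRight {N : Type u} [AddCommGroup N] [Module S N] (y : N) : ω →ₗ[R] BTensor S ω N where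
  toFun x := BTensor.tmul S x y
  map_add' x x' := BTensor.add_tmul S x x' y
  map_smul' r x := (BTensor.smul_tmul_left S R r x y).symm

/-- `μ_N : N → (ω ⊗_S N)_*`, `μ_N(y)(x) = x ⊗ y`. -/
def unitMap (N : Type u) [AddCommGroup N] [Module S N] :
    N →ₗ[S] HomFrom R S ω (BTensor S ω N) where
  toFun y := tmulRight R S ω y
  map_add' y y' := LinearMap.ext fun x => BTensor.tmul_add S x y y'
  map_smul' s y := LinearMap.ext fun x => (BTensor.smul_tmul S x s y).symm

/-! ### Resolutions and relative dimensions -/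

/-- `M` admits a degreewise finite projective resolution: an exact sequence
`⋯ → P₁ → P₀ → M → 0` with all `Pᵢ` finitely generated projective. -/
def HasDegreewiseFiniteProjRes (T : Type u) [Ring T] (M : Type u) [AddCommGroup M] [Module T M] :
    Prop :=
  ∃ (P : ℕ → ModuleCat.{u} T) (d : ∀ i, P (i + 1) →ₗ[T] P i) (ε : P 0 →ₗ[T] M),
    (∀ i, Module.Finite T (P i) ∧ Module.Projective T (P i)) ∧
    Function.Surjective ε ∧ Function.Exact (d 0) ε ∧ ∀ i, Function.Exact (d (i + 1)) (d i)

/-- There is an exact sequence `0 → Xₙ → ⋯ → X₁ → X₀ → M → 0` with all `Xᵢ` in `𝒳`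
(extended by zero modules in degrees `> n`). -/
def HasResolution {T : Type u} [Ring T] (𝒳 : ModuleCat.{u} T → Prop) (M : ModuleCat.{u} T)
    (n : ℕ) : Prop :=
  ∃ (X : ℕ → ModuleCat.{u} T) (d : ∀ i, X (i + 1) →ₗ[T] X i) (ε : X 0 →ₗ[T] M),
    (∀ i ≤ n, 𝒳 (X i)) ∧ (∀ i > n, Subsingleton (X i)) ∧
    Function.Surjective ε ∧ Function.Exact (d 0) ε ∧ ∀ i, Function.Exact (d (i + 1)) (d i)

/-- There is an exact sequence `0 → M → X⁰ → X¹ → ⋯ → Xⁿ → 0` with all `Xⁱ` in `𝒳`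
(extended by zero modules in degrees `> n`). -/
def HasCoresolution {T : Type u} [Ring T] (𝒳 : ModuleCat.{u} T → Prop) (M : ModuleCat.{u} T)
    (n : ℕ) : Prop :=
  ∃ (X : ℕ → ModuleCat.{u} T) (d : ∀ i, X i →ₗ[T] X (i + 1)) (η : M →ₗ[T] X 0),
    (∀ i ≤ n, 𝒳 (X i)) ∧ (∀ i > n, Subsingleton (X i)) ∧
    Function.Injective η ∧ Function.Exact η (d 0) ∧ ∀ i, Function.Exact (d i) (d (i + 1))

/-- The `𝒳`-projective dimension (`⊤` if there is no finite `𝒳`-resolution). -/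
def relProjDim {T : Type u} [Ring T] (𝒳 : ModuleCat.{u} T → Prop) (M : ModuleCat.{u} T) : ℕ∞ :=
  ⨅ (n : ℕ) (_ : HasResolution 𝒳 M n), (n : ℕ∞)

/-- The `𝒳`-injective dimension (`⊤` if there is no finite `𝒳`-coresolution). -/
def relInjDim {T : Type u} [Ring T] (𝒳 : ModuleCat.{u} T → Prop) (M : ModuleCat.{u} T) : ℕ∞ :=
  ⨅ (n : ℕ) (_ : HasCoresolution 𝒳 M n), (n : ℕ∞)

/-- The flat dimension: the least length of a flat resolution. -/
def flatDim {T : Type u} [Ring T] (M : ModuleCat.{u} T) : ℕ∞ :=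
  relProjDim (fun F : ModuleCat.{u} T => IsFlat T F) M

/-- The projective dimension, with the convention that the zero module has dimension `0`
(Mathlib's value there is `⊥`), in accordance with `relProjDim`. -/
def projDim {T : Type u} [Ring T] (M : ModuleCat.{u} T) : ℕ∞ :=
  (projectiveDimension M).unbotD 0

/-- The injective dimension, with the convention that the zero module has dimension `0`
(Mathlib's value there is `⊥`), in accordance with `relInjDim`. -/
def injDim {T : Type u} [Ring T] (M : ModuleCat.{u} T) : ℕ∞ :=
  (injectiveDimension M).unbotD 0

/-! ### Semidualizing bimodules and the associated classes -/

/-- `ω` is a semidualizing `(R,S)`-bimodule. -/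
structure IsSemidualizing : Prop where
  finite_res_left : HasDegreewiseFiniteProjRes R ω
  finite_res_right : HasDegreewiseFiniteProjRes Sᵐᵒᵖ ω
  /-- `R → Hom_{Sᵒᵖ}(ω, ω)`, `r ↦ (x ↦ r x)`, is bijective. -/
  homothety_left : Function.Bijective (fun r : R => Module.toModuleEnd Sᵐᵒᵖ ω r)
  /-- `S → Hom_R(ω, ω)`, `s ↦ (x ↦ x s)`, is bijective. -/
  homothety_right : Function.Bijective (fun s : S => rightMul R S ω s)
  ext_left : ∀ i ≥ 1, Subsingleton (Abelian.Ext (ModuleCat.of R ω) (ModuleCat.of R ω) i)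
  ext_right : ∀ i ≥ 1, Subsingleton (Abelian.Ext (ModuleCat.of Sᵐᵒᵖ ω) (ModuleCat.of Sᵐᵒᵖ ω) i)

/-- `𝓕_ω(R)`: the modules (isomorphic to) `ω ⊗_S F` with `F` flat. -/
def IsOmegaFlat (M : ModuleCat.{u} R) : Prop :=
  ∃ F : ModuleCat.{u} S, IsFlat S F ∧ Nonempty (M ≃ₗ[R] BTensor S ω F)

/-- `𝓟_ω(R)`: the modules (isomorphic to) `ω ⊗_S P` with `P` projective. -/
def IsOmegaProjective (M : ModuleCat.{u} R) : Prop :=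
  ∃ P : ModuleCat.{u} S, Module.Projective S P ∧ Nonempty (M ≃ₗ[R] BTensor S ω P)

/-- `𝓘_ω(S)`: the modules (isomorphic to) `Hom_R(ω, I)` with `I` injective. -/
def IsOmegaInjective (N : ModuleCat.{u} S) : Prop :=
  ∃ I : ModuleCat.{u} R, Module.Injective R I ∧ Nonempty (N ≃ₗ[S] HomFrom R S ω I)

/-- A submodule is essential if it meets every nonzero submodule nontrivially. -/
def IsEssential {T : Type u} [Ring T] {M : Type u} [AddCommGroup M] [Module T M]
    (K : Submodule T M) : Prop :=
  ∀ L : Submodule T M, K ⊓ L = ⊥ → L = ⊥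

/-- `0 → M → I⁰ → I¹` is the beginning of a minimal injective resolution of `M`:
it is exact, `I⁰` is an injective hull of `M` and `I¹` is an injective hull of the image of `f`. -/
structure IsMinimalInjCopresentation {T : Type u} [Ring T] {M I₀ I₁ : ModuleCat.{u} T}
    (η : M →ₗ[T] I₀) (f : I₀ →ₗ[T] I₁) : Prop where
  injective_zero : Module.Injective T I₀
  injective_one : Module.Injective T I₁
  mono : Function.Injective η
  exact : Function.Exact η f
  essential_zero : IsEssential (LinearMap.range η)
  essential_one : IsEssential (LinearMap.range f)

/-- `Coker f_*`; for `f = f⁰ : I⁰(M) → I¹(M)` in a minimal injective resolution of `M` this is the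
cotranspose of `M`. -/
def cokerStar {I₀ I₁ : ModuleCat.{u} R} (f : I₀ →ₗ[R] I₁) : ModuleCat.{u} S :=
  ModuleCat.of S (HomFrom R S ω I₁ ⧸ LinearMap.range (HomFrom.map R S ω f))

/-- `M` is `n`-`ω`-cotorsionfree: `Tor_i^S(ω, cTr_ω M) = 0` for `1 ≤ i ≤ n`, where
`cTr_ω M = Coker f⁰_*` for a minimal injective resolution of `M` (unique up to isomorphism). -/
def IsCotorsionfree (n : ℕ) (M : ModuleCat.{u} R) : Prop :=
  ∃ (I₀ I₁ : ModuleCat.{u} R) (η : M →ₗ[R] I₀) (f : I₀ →ₗ[R] I₁),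
    IsMinimalInjCopresentation η f ∧
    ∀ i, 1 ≤ i → i ≤ n → Limits.IsZero (tor R S ω i (cokerStar R S ω f))

/-- `M` is `∞`-`ω`-cotorsionfree. -/
def IsInftyCotorsionfree (M : ModuleCat.{u} R) : Prop :=
  ∀ n : ℕ, IsCotorsionfree R S ω n M

/-- The Auslander class `𝓐_ω(S)`. -/
structure InAuslanderClass (N : ModuleCat.{u} S) : Prop where
  tor_zero : ∀ i ≥ 1, Limits.IsZero (tor R S ω i N)
  ext_zero : ∀ i ≥ 1,
    Subsingleton (Abelian.Ext (ModuleCat.of R ω) (ModuleCat.of R (BTensor S ω N)) i)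
  unit_bijective : Function.Bijective (unitMap R S ω N)

end Bimodule

end SemiDual

end

/-!
The functors `Hom_R(ω, -)` and `ω ⊗_S -` carry the relevant (co)resolutions to each other.
Evaluating on a resolution of `ω` by finitely generated projectives shows that, for `F` flat,
`ω ⊗_S F` is `Ext_R(ω, -)`-acyclic and `F → (ω ⊗_S F)_*` is bijective; dually, for `I` injective,
`I_*` is `Tor^S(ω, -)`-acyclic and `ω ⊗_S I_* → I` is bijective. Dimension shifting keeps the
sequences exact, which gives the inequalities. If `M` is `∞`-`ω`-cotorsionfree, shifting along
`0 → M_* → I⁰_* → I¹_* → Coker f⁰_* → 0` gives `Tor^S_i(ω, M_*) = 0` for `i ≥ 1`, and comparing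
`ω ⊗_S -` of this sequence with `0 → M → I⁰ → I¹` gives `ω ⊗_S M_* ≅ M`, so that a resolution of
`M_*` can be tensored back to one of `M`. If `N` is in the Auslander class, `Hom_R(ω, -)` turns an
injective coresolution of `ω ⊗_S N` back into a coresolution of `(ω ⊗_S N)_* ≅ N`.
-/

noncomputable section

namespace SemiDual

/-! ### Balanced tensor products -/

theorem exact_of_surjective_ladder {X₁ X₂ X₃ Y₁ Y₂ Y₃ : Type*} [AddCommGroup X₁] [AddCommGroup X₂]
    [AddCommGroup X₃] [AddCommGroup Y₁] [AddCommGroup Y₂] [AddCommGroup Y₃]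
    {α : X₁ →+ X₂} {β : X₂ →+ X₃} {α' : Y₁ →+ Y₂} {β' : Y₂ →+ Y₃}
    {p : X₁ →+ Y₁} {q : X₂ →+ Y₂} {r : X₃ →+ Y₃}
    (hα : ∀ x, α' (p x) = q (α x)) (hβ : ∀ x, β' (q x) = r (β x)) (h : Function.Exact α β)
    (hp : Function.Surjective p) (hq : Function.Surjective q)
    (hr : ∀ z, r z = 0 → ∃ y, q y = 0 ∧ β y = z) : Function.Exact α' β' := by
  intro t
  constructor
  · intro ht
    obtain ⟨y, rfl⟩ := hq t
    obtain ⟨y', hy', hyy'⟩ := hr (β y) (by rw [← hβ, ht])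
    obtain ⟨x, hx⟩ := (h (y - y')).1 (by rw [map_sub, hyy', sub_self])
    exact ⟨p x, by rw [hα, hx, map_sub, hy', sub_zero]⟩
  · rintro ⟨t, rfl⟩
    obtain ⟨x, rfl⟩ := hp t
    rw [hα, hβ, h.apply_apply_eq_zero, map_zero]

theorem exact_rangeRestrict {T A B C : Type*} [Ring T] [AddCommGroup A] [Module T A]
    [AddCommGroup B] [Module T B] [AddCommGroup C] [Module T C] {f : A →ₗ[T] B} {g : B →ₗ[T] C}
    (hfg : Function.Exact f g) : Function.Exact f g.rangeRestrict :=
  (LinearMap.range g).injective_subtype.comp_exact_iff_exact.1 hfg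

namespace BTensor

variable (S : Type u) [Ring S] {A B C N N' N'' : Type u}
  [AddCommGroup A] [Module Sᵐᵒᵖ A] [AddCommGroup B] [Module Sᵐᵒᵖ B]
  [AddCommGroup C] [Module Sᵐᵒᵖ C] [AddCommGroup N] [Module S N] [AddCommGroup N'] [Module S N']
  [AddCommGroup N''] [Module S N'']

@[simp] theorem tmul_zero (x : A) : tmul S x (0 : N) = 0 := by
  simp [tmul]

@[simp] theorem zero_tmul (n : N) : tmul S (0 : A) n = 0 := by
  simp [tmul]

theorem sum_tmul {ι : Type*} (s : Finset ι) (x : ι → A) (n : N) :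
    tmul S (∑ i ∈ s, x i) n = ∑ i ∈ s, tmul S (x i) n := by
  simp only [tmul, TensorProduct.sum_tmul, map_sum]

theorem tmul_sum {ι : Type*} (s : Finset ι) (x : A) (n : ι → N) :
    tmul S x (∑ i ∈ s, n i) = ∑ i ∈ s, tmul S x (n i) := by
  simp only [tmul, TensorProduct.tmul_sum, map_sum]

theorem mk_eq_zero_iff (z : A ⊗[ℤ] N) : mk S z = 0 ↔ z ∈ balancedRel S A N :=
  Submodule.Quotient.mk_eq_zero _

variable (A) in
/-- The homomorphism `A ⊗ g` for a right module `A` without further structure; `lTensor` is this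
map for a bimodule. -/
def lMap (g : N →ₗ[S] N') : BTensor S A N →+ BTensor S A N' :=
  lift S
    (AddMonoidHom.mk' (fun x => AddMonoidHom.mk' (fun n => tmul S x (g n))
      (fun n n' => by simp [tmul_add]))
      (fun x x' => by ext n; simp [add_tmul]))
    (fun x s n => by simp [smul_tmul])

@[simp] theorem lMap_tmul (g : N →ₗ[S] N') (x : A) (n : N) :
    lMap S A g (tmul S x n) = tmul S x (g n) :=
  rfl

theorem lMap_rTensor (f : A →ₗ[Sᵐᵒᵖ] B) (g : N →ₗ[S] N') (t : BTensor S A N) :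
    lMap S B g (rTensor S N f t) = rTensor S N' f (lMap S A g t) :=
  DFunLike.congr_fun (f := (lMap S B g).comp (rTensor S N f))
    (g := (rTensor S N' f).comp (lMap S A g)) (hom_ext S fun x n => by simp) t

theorem lMap_lMap (f : N →ₗ[S] N') (g : N' →ₗ[S] N'') (t : BTensor S A N) :
    lMap S A g (lMap S A f t) = lMap S A (g.comp f) t :=
  DFunLike.congr_fun (f := (lMap S A g).comp (lMap S A f))
    (g := lMap S A (g.comp f)) (hom_ext S fun x n => by simp) t

theorem rTensor_rTensor (f : A →ₗ[Sᵐᵒᵖ] B) (g : B →ₗ[Sᵐᵒᵖ] C) (t : BTensor S A N) :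
    rTensor S N g (rTensor S N f t) = rTensor S N (g.comp f) t :=
  DFunLike.congr_fun (f := (rTensor S N g).comp (rTensor S N f))
    (g := rTensor S N (g.comp f)) (hom_ext S fun x n => by simp) t

@[simp] theorem lMap_id (t : BTensor S A N) : lMap S A (LinearMap.id : N →ₗ[S] N) t = t :=
  DFunLike.congr_fun (f := lMap S A (LinearMap.id : N →ₗ[S] N)) (g := AddMonoidHom.id _)
    (hom_ext S fun x n => by simp) t

variable (A) in
/-- `A ⊗ e` for an isomorphism `e`. -/
def lCongr (e : N ≃ₗ[S] N') : BTensor S A N ≃+ BTensor S A N' :=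
  { lMap S A e.toLinearMap with
    invFun := lMap S A e.symm.toLinearMap
    left_inv := fun t => (lMap_lMap S _ _ t).trans (by simp)
    right_inv := fun t => (lMap_lMap S _ _ t).trans (by simp) }

section RightExact

variable (A) in
theorem lMap_mk (g : N →ₗ[S] N') (z : A ⊗[ℤ] N) :
    lMap S A g (mk S z) = mk S ((g.restrictScalars ℤ).lTensor A z) := by
  induction z using TensorProduct.induction_on with
  | zero => simp only [map_zero]
  | tmul x n => rfl
  | add z z' h h' => simp only [map_add, h, h']

theorem rTensor_mk (f : A →ₗ[Sᵐᵒᵖ] B) (z : A ⊗[ℤ] N) :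
    rTensor S N f (mk S z) = mk S ((f.restrictScalars ℤ).rTensor N z) := by
  induction z using TensorProduct.induction_on with
  | zero => simp only [map_zero]
  | tmul x n => exact rTensor_tmul S f x n
  | add z z' h h' => simp only [map_add, h, h']

theorem lMap_surjective {g : N →ₗ[S] N'} (hg : Function.Surjective g) :
    Function.Surjective (lMap S A g) := fun t => by
  obtain ⟨z, rfl⟩ := mk_surjective S t
  obtain ⟨w, rfl⟩ := LinearMap.lTensor_surjective A (g := g.restrictScalars ℤ) hg z
  exact ⟨mk S w, lMap_mk S A g w⟩

theorem rTensor_surjective {f : A →ₗ[Sᵐᵒᵖ] B} (hf : Function.Surjective f) :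
    Function.Surjective (rTensor S N f) := fun t => by
  obtain ⟨z, rfl⟩ := mk_surjective S t
  obtain ⟨w, rfl⟩ := LinearMap.rTensor_surjective N (g := f.restrictScalars ℤ) hf z
  exact ⟨mk S w, rTensor_mk S f w⟩

variable (A) in
theorem balancedRel_le_map_lTensor {g : N →ₗ[S] N'} (hg : Function.Surjective g) :
    balancedRel S A N' ≤ (balancedRel S A N).map ((g.restrictScalars ℤ).lTensor A) := by
  refine Submodule.span_le.2 ?_
  rintro _ ⟨x, s, n, rfl⟩
  obtain ⟨m, rfl⟩ := hg n
  exact ⟨_, Submodule.subset_span ⟨x, s, m, rfl⟩, by simp⟩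

variable (N) in
theorem balancedRel_le_map_rTensor {f : A →ₗ[Sᵐᵒᵖ] B} (hf : Function.Surjective f) :
    balancedRel S B N ≤ (balancedRel S A N).map ((f.restrictScalars ℤ).rTensor N) := by
  refine Submodule.span_le.2 ?_
  rintro _ ⟨y, s, n, rfl⟩
  obtain ⟨x, rfl⟩ := hf y
  exact ⟨_, Submodule.subset_span ⟨x, s, n, rfl⟩, by simp⟩

theorem lMap_exact {f : N →ₗ[S] N'} {g : N' →ₗ[S] N''} (hfg : Function.Exact f g)
    (hg : Function.Surjective g) : Function.Exact (lMap S A f) (lMap S A g) := by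
  refine exact_of_surjective_ladder
    (α := ((f.restrictScalars ℤ).lTensor A).toAddMonoidHom)
    (β := ((g.restrictScalars ℤ).lTensor A).toAddMonoidHom) (lMap_mk S A f) (lMap_mk S A g)
    (_root_.lTensor_exact A (f := f.restrictScalars ℤ) (g := g.restrictScalars ℤ) hfg hg)
    (mk_surjective S) (mk_surjective S) fun z hz => ?_
  obtain ⟨w, hw, rfl⟩ := balancedRel_le_map_lTensor S A hg ((mk_eq_zero_iff S z).1 hz)
  exact ⟨w, (mk_eq_zero_iff S w).2 hw, rfl⟩

theorem rTensor_exact {f : A →ₗ[Sᵐᵒᵖ] B} {g : B →ₗ[Sᵐᵒᵖ] C} (hfg : Function.Exact f g)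
    (hg : Function.Surjective g) : Function.Exact (rTensor S N f) (rTensor S N g) := by
  refine exact_of_surjective_ladder
    (α := ((f.restrictScalars ℤ).rTensor N).toAddMonoidHom)
    (β := ((g.restrictScalars ℤ).rTensor N).toAddMonoidHom) (rTensor_mk S f) (rTensor_mk S g)
    (_root_.rTensor_exact N (f := f.restrictScalars ℤ) (g := g.restrictScalars ℤ) hfg hg)
    (mk_surjective S) (mk_surjective S) fun z hz => ?_
  obtain ⟨w, hw, rfl⟩ := balancedRel_le_map_rTensor S N hg ((mk_eq_zero_iff S z).1 hz)
  exact ⟨w, (mk_eq_zero_iff S w).2 hw, rfl⟩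

end RightExact

section Contraction

/-- The homomorphism `A ⊗_S N → N`, `a ⊗ n ↦ φ(a) n`, for a functional `φ` on `A`. -/
def contract (φ : A →ₗ[Sᵐᵒᵖ] Sᵐᵒᵖ) : BTensor S A N →+ N :=
  lift S
    (AddMonoidHom.mk' (fun x => AddMonoidHom.mk' (fun n => (φ x).unop • n)
      (fun n n' => smul_add _ _ _))
      (fun x x' => by ext n; simp [add_smul]))
    (fun x s n => by simp [mul_smul])

@[simp] theorem contract_tmul (φ : A →ₗ[Sᵐᵒᵖ] Sᵐᵒᵖ) (x : A) (n : N) :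
    contract S φ (tmul S x n) = (φ x).unop • n :=
  rfl

/-- The homomorphism `A ⊗_S N → A`, `a ⊗ n ↦ a φ(n)`, for a functional `φ` on `N`. -/
def contractRight (φ : N →ₗ[S] S) : BTensor S A N →+ A :=
  lift S
    (AddMonoidHom.mk' (fun x => AddMonoidHom.mk' (fun n => MulOpposite.op (φ n) • x)
      (fun n n' => by simp [add_smul]))
      (fun x x' => by ext n; simp))
    (fun x s n => by simp [mul_smul])

@[simp] theorem contractRight_tmul (φ : N →ₗ[S] S) (x : A) (n : N) :
    contractRight S φ (tmul S x n) = MulOpposite.op (φ n) • x :=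
  rfl

theorem contract_lMap (φ : A →ₗ[Sᵐᵒᵖ] Sᵐᵒᵖ) (g : N →ₗ[S] N') (t : BTensor S A N) :
    contract S φ (lMap S A g t) = g (contract S φ t) :=
  DFunLike.congr_fun (f := (contract S φ).comp (lMap S A g))
    (g := g.toAddMonoidHom.comp (contract S φ)) (hom_ext S fun x n => by simp) t

theorem contractRight_rTensor (φ : N →ₗ[S] S) (f : A →ₗ[Sᵐᵒᵖ] B) (t : BTensor S A N) :
    contractRight S φ (rTensor S N f t) = f (contractRight S φ t) :=
  DFunLike.congr_fun (f := (contractRight S φ).comp (rTensor S N f))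
    (g := f.toAddMonoidHom.comp (contractRight S φ)) (hom_ext S fun x n => by simp) t

/-- Only finitely many of the functionals `a ↦ s(a)_j` matter for a given tensor, but this is not
visible from its contractions; hence the formulation with all large enough finite sets. -/
theorem exists_sum_tmul_contract {s : A →ₗ[Sᵐᵒᵖ] A →₀ Sᵐᵒᵖ}
    (hs : (Finsupp.linearCombination Sᵐᵒᵖ id).comp s = LinearMap.id) (t : BTensor S A N) :
    ∃ J₀ : Finset A, ∀ J, J₀ ⊆ J →
      ∑ j ∈ J, tmul S j (contract S ((Finsupp.lapply j).comp s) t) = t := by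
  classical
  induction t using induction_on with
  | zero => exact ⟨∅, by simp⟩
  | tmul a n =>
    refine ⟨(s a).support, fun J hJ => ?_⟩
    have ha : ∑ j ∈ J, s a j • j = a := by
      rw [← Finsupp.sum_of_support_subset _ hJ (fun j r => r • j) (by simp)]
      exact LinearMap.congr_fun hs a
    conv_rhs => rw [← ha, sum_tmul]
    exact Finset.sum_congr rfl fun j _ => (smul_tmul S j (s a j).unop n).symm
  | add t t' h h' =>
    obtain ⟨J₀, hJ₀⟩ := h
    obtain ⟨J₀', hJ₀'⟩ := h'
    refine ⟨J₀ ∪ J₀', fun J hJ => ?_⟩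
    simp only [map_add, tmul_add, Finset.sum_add_distrib, hJ₀ J (Finset.union_subset_left hJ),
      hJ₀' J (Finset.union_subset_right hJ)]

theorem exists_sum_contractRight_tmul {s : N →ₗ[S] N →₀ S}
    (hs : (Finsupp.linearCombination S id).comp s = LinearMap.id) (t : BTensor S A N) :
    ∃ J₀ : Finset N, ∀ J, J₀ ⊆ J →
      ∑ j ∈ J, tmul S (contractRight S ((Finsupp.lapply j).comp s) t) j = t := by
  classical
  induction t using induction_on with
  | zero => exact ⟨∅, by simp⟩
  | tmul a n =>
    refine ⟨(s n).support, fun J hJ => ?_⟩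
    have hn : ∑ j ∈ J, s n j • j = n := by
      rw [← Finsupp.sum_of_support_subset _ hJ (fun j r => r • j) (by simp)]
      exact LinearMap.congr_fun hs n
    conv_rhs => rw [← hn, tmul_sum]
    exact Finset.sum_congr rfl fun j _ => smul_tmul S a (s n j) j
  | add t t' h h' =>
    obtain ⟨J₀, hJ₀⟩ := h
    obtain ⟨J₀', hJ₀'⟩ := h'
    refine ⟨J₀ ∪ J₀', fun J hJ => ?_⟩
    simp only [map_add, add_tmul, Finset.sum_add_distrib, hJ₀ J (Finset.union_subset_left hJ),
      hJ₀' J (Finset.union_subset_right hJ)]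

theorem eq_zero_of_contract [Module.Projective Sᵐᵒᵖ A] {t : BTensor S A N}
    (h : ∀ φ : A →ₗ[Sᵐᵒᵖ] Sᵐᵒᵖ, contract S φ t = 0) : t = 0 := by
  obtain ⟨s, hs⟩ := Module.projective_def'.1 ‹Module.Projective Sᵐᵒᵖ A›
  obtain ⟨J, hJ⟩ := exists_sum_tmul_contract S hs t
  rw [← hJ J subset_rfl]
  exact Finset.sum_eq_zero fun j _ => by rw [h, tmul_zero]

theorem eq_zero_of_contractRight [Module.Projective S N] {t : BTensor S A N}
    (h : ∀ φ : N →ₗ[S] S, contractRight S φ t = 0) : t = 0 := by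
  obtain ⟨s, hs⟩ := Module.projective_def'.1 ‹Module.Projective S N›
  obtain ⟨J, hJ⟩ := exists_sum_contractRight_tmul S hs t
  rw [← hJ J subset_rfl]
  exact Finset.sum_eq_zero fun j _ => by rw [h, zero_tmul]

theorem lMap_injective [Module.Projective Sᵐᵒᵖ A] {g : N →ₗ[S] N'}
    (hg : Function.Injective g) : Function.Injective (lMap S A g) :=
  (injective_iff_map_eq_zero _).2 fun t ht => eq_zero_of_contract S fun φ =>
    hg (by rw [← contract_lMap, ht, map_zero, map_zero])

end Contraction

end BTensor

section Flat

open BTensor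

variable {S : Type u} [Ring S]

theorem IsFlat.of_projective (N : Type u) [AddCommGroup N] [Module S N] [Module.Projective S N] :
    IsFlat S N := fun _ _ _ _ _ _ f hf =>
  (injective_iff_map_eq_zero _).2 fun t ht => eq_zero_of_contractRight S fun φ =>
    hf (by rw [← contractRight_rTensor, ht, map_zero, map_zero])

theorem IsFlat.exact {F : Type u} [AddCommGroup F] [Module S F] (hF : IsFlat S F)
    {A B C : Type u} [AddCommGroup A] [Module Sᵐᵒᵖ A] [AddCommGroup B] [Module Sᵐᵒᵖ B]
    [AddCommGroup C] [Module Sᵐᵒᵖ C] {f : A →ₗ[Sᵐᵒᵖ] B} {g : B →ₗ[Sᵐᵒᵖ] C}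
    (hfg : Function.Exact f g) : Function.Exact (rTensor S F f) (rTensor S F g) := by
  have h := (BTensor.rTensor_exact S (N := F) (exact_rangeRestrict hfg)
    g.surjective_rangeRestrict).comp_injective _
      (hF _ _ _ (LinearMap.range g).injective_subtype) (map_zero _)
  have hg : rTensor S F (LinearMap.range g).subtype ∘ rTensor S F g.rangeRestrict =
      rTensor S F g := funext fun t => rTensor_rTensor S _ _ t
  rwa [hg] at h

theorem IsFlat.of_equiv {F F' : Type u} [AddCommGroup F] [Module S F] [AddCommGroup F']
    [Module S F'] (e : F ≃ₗ[S] F') (hF : IsFlat S F) : IsFlat S F' := by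
  intro A B _ _ _ _ f hf
  have h : rTensor S F' f ∘ lCongr S A e = lCongr S B e ∘ rTensor S F f :=
    funext fun t => (lMap_rTensor S f e.toLinearMap t).symm
  rw [← EquivLike.injective_comp (lCongr S A e), h]
  exact (lCongr S B e).injective.comp (hF A B f hf)

end Flat

/-! ### Ext and projective resolutions -/

section HomExact

variable {T : Type u} {T' : Type*} [Ring T] [Ring T'] {A B C : Type u} [AddCommGroup A] [Module T A]
  [AddCommGroup B] [Module T B] [AddCommGroup C] [Module T C] {f : A →ₗ[T] B} {g : B →ₗ[T] C}
  {M : Type u} [AddCommGroup M] [Module T M] [Module T' M] [SMulCommClass T T' M]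

theorem lcomp_exact_of_surjective (hfg : Function.Exact f g) (hg : Function.Surjective g) :
    Function.Exact (LinearMap.lcomp T' M g) (LinearMap.lcomp T' M f) := by
  intro h
  constructor
  · intro hh
    refine ⟨((LinearMap.range f).liftQ h (LinearMap.range_le_ker_iff.2 hh)).comp
      (hfg.linearEquivOfSurjective hg).symm.toLinearMap, LinearMap.ext fun x => ?_⟩
    simp
  · rintro ⟨k, rfl⟩
    exact LinearMap.ext fun x => by simp [hfg.apply_apply_eq_zero]

theorem lcomp_exact_of_injective [Module.Injective T M] (hfg : Function.Exact f g) :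
    Function.Exact (LinearMap.lcomp T' M g) (LinearMap.lcomp T' M f) := by
  intro h
  constructor
  · intro hh
    obtain ⟨k, rfl⟩ := (lcomp_exact_of_surjective (exact_rangeRestrict hfg)
      g.surjective_rangeRestrict h).1 hh
    obtain ⟨l, rfl⟩ := Module.Injective.extension_property T M (LinearMap.range g) C
      (LinearMap.range g).subtype (LinearMap.range g).injective_subtype k
    exact ⟨l, rfl⟩
  · rintro ⟨k, rfl⟩
    exact LinearMap.ext fun x => by simp [hfg.apply_apply_eq_zero]

end HomExact

section Ext

variable {T : Type u} [Ring T]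

theorem subsingleton_ext_succ_iff {𝒮 : ShortComplex (ModuleCat.{u} T)} (h𝒮 : 𝒮.ShortExact)
    [Projective 𝒮.X₂] (M : ModuleCat.{u} T) (i : ℕ) :
    Subsingleton (Abelian.Ext 𝒮.X₃ M (i + 2)) ↔ Subsingleton (Abelian.Ext 𝒮.X₁ M (i + 1)) := by
  refine ⟨fun _ => subsingleton_of_forall_eq 0 fun x => ?_, fun _ =>
    (precomp_extClass_surjective_of_projective_X₂ M h𝒮 (i + 1)).subsingleton⟩
  obtain ⟨y, rfl⟩ := Abelian.Ext.contravariant_sequence_exact₁ h𝒮 M x (n₁ := i + 2)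
    (by omega) (Subsingleton.elim _ _)
  rw [Abelian.Ext.eq_zero_of_projective y, Abelian.Ext.comp_zero]

theorem subsingleton_ext_one_iff {𝒮 : ShortComplex (ModuleCat.{u} T)} (h𝒮 : 𝒮.ShortExact)
    [Projective 𝒮.X₂] (M : ModuleCat.{u} T) :
    Subsingleton (Abelian.Ext 𝒮.X₃ M 1) ↔ ∀ f : 𝒮.X₁ ⟶ M, ∃ g, 𝒮.f ≫ g = f := by
  constructor
  · intro _ f
    obtain ⟨x, hx⟩ := Abelian.Ext.contravariant_sequence_exact₁ h𝒮 M (Abelian.Ext.mk₀ f)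
      (n₁ := 1) rfl (Subsingleton.elim _ _)
    obtain ⟨g, rfl⟩ := (Abelian.Ext.mk₀_bijective _ _).2 x
    rw [Abelian.Ext.mk₀_comp_mk₀] at hx
    exact ⟨g, (Abelian.Ext.mk₀_bijective _ _).1 hx⟩
  · intro h
    refine subsingleton_of_forall_eq 0 fun x => ?_
    obtain ⟨y, rfl⟩ := precomp_extClass_surjective_of_projective_X₂ M h𝒮 0 x
    obtain ⟨f, rfl⟩ := (Abelian.Ext.mk₀_bijective _ _).2 y
    obtain ⟨g, rfl⟩ := h f
    rw [← Abelian.Ext.mk₀_comp_mk₀]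
    exact h𝒮.extClass_comp_assoc _ (h := add_zero 1)

/-- `Extⁱ(X, M) = 0` for all `i ≥ 1`. -/
def IsExtAcyclic (X M : ModuleCat.{u} T) : Prop :=
  ∀ i ≥ 1, Subsingleton (Abelian.Ext X M i)

theorem IsExtAcyclic.of_injective (X M : ModuleCat.{u} T) [Module.Injective T M] :
    IsExtAcyclic X M := fun i hi => by
  obtain ⟨i, rfl⟩ := Nat.exists_eq_add_of_le' hi
  have := Module.injective_object_of_injective_module T M
  exact subsingleton_of_forall_eq 0 Abelian.Ext.eq_zero_of_injective

theorem IsExtAcyclic.of_linearEquiv {X M M' : ModuleCat.{u} T} (e : M ≃ₗ[T] M')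
    (h : IsExtAcyclic X M) : IsExtAcyclic X M' := fun i hi =>
  have : Subsingleton ((Abelian.extFunctorObj X i).obj M) := h i hi
  let φ : M' ≅ M := e.symm.toModuleIso
  ((Abelian.extFunctorObj X i).mapIso φ).addCommGroupIsoToAddEquiv.injective.subsingleton

variable {X A B C : ModuleCat.{u} T} {f : A →ₗ[T] B} {g : B →ₗ[T] C}

theorem shortExact_of_exact (hf : Function.Injective f) (hfg : Function.Exact f g)
    (hg : Function.Surjective g) :
    (ModuleCat.shortComplexOfCompEqZero f g hfg.linearMap_comp_eq_zero).ShortExact :=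
  ModuleCat.shortComplex_shortExact _ hfg hf hg

theorem IsExtAcyclic.of_exact (hf : Function.Injective f) (hfg : Function.Exact f g)
    (hg : Function.Surjective g) (hA : IsExtAcyclic X A) (hB : IsExtAcyclic X B) :
    IsExtAcyclic X C := fun i hi => by
  have := hA (i + 1) (by omega)
  have := hB i hi
  refine subsingleton_of_forall_eq 0 fun x => ?_
  obtain ⟨y, rfl⟩ := Abelian.Ext.covariant_sequence_exact₃ X (shortExact_of_exact hf hfg hg) x
    rfl (Subsingleton.elim (α := Abelian.Ext X A (i + 1)) _ _)
  rw [Subsingleton.elim (α := Abelian.Ext X B i) y 0, Abelian.Ext.zero_comp]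

theorem exists_lift_of_subsingleton_ext (hf : Function.Injective f) (hfg : Function.Exact f g)
    (hg : Function.Surjective g) [Subsingleton (Abelian.Ext X A 1)] (c : X →ₗ[T] C) :
    ∃ b : X →ₗ[T] B, g.comp b = c := by
  obtain ⟨x, hx⟩ := Abelian.Ext.covariant_sequence_exact₃ X (shortExact_of_exact hf hfg hg)
    (Abelian.Ext.mk₀ (ModuleCat.ofHom c)) rfl
    (Subsingleton.elim (α := Abelian.Ext X A 1) _ _)
  obtain ⟨b, rfl⟩ := (Abelian.Ext.mk₀_bijective _ _).2 x
  rw [Abelian.Ext.mk₀_comp_mk₀] at hx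
  exact ⟨b.hom, congrArg ModuleCat.Hom.hom ((Abelian.Ext.mk₀_bijective _ _).1 hx)⟩

end Ext

/-- A resolution `⋯ → P₁ → P₀ → X → 0` by projective modules, as a sequence of linear maps. -/
structure ProjRes (T : Type u) [Ring T] (X : Type u) [AddCommGroup X] [Module T X] where
  P : ℕ → ModuleCat.{u} T
  d : ∀ i, P (i + 1) →ₗ[T] P i
  ε : P 0 →ₗ[T] X
  projective : ∀ i, Module.Projective T (P i)
  surjective : Function.Surjective ε
  exact_zero : Function.Exact (d 0) ε
  exact_succ : ∀ i, Function.Exact (d (i + 1)) (d i)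

namespace ProjRes

attribute [instance] ProjRes.projective

/-- All terms of the resolution are finitely generated. -/
class DegreewiseFinite {T : Type u} [Ring T] {X : Type u} [AddCommGroup X] [Module T X]
    (Q : ProjRes T X) : Prop where
  finite : ∀ i, Module.Finite T (Q.P i)

attribute [instance] DegreewiseFinite.finite

variable {T : Type u} [Ring T] {X : Type u} [AddCommGroup X] [Module T X] (Q : ProjRes T X)

/-- The induced resolution of the kernel of the augmentation. -/
def shift : ProjRes T (LinearMap.ker Q.ε) where
  P i := Q.P (i + 1)
  d i := Q.d (i + 1)
  ε := (Q.d 0).codRestrict _ Q.exact_zero.apply_apply_eq_zero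
  projective i := Q.projective (i + 1)
  surjective := by
    rintro ⟨x, hx⟩
    obtain ⟨y, rfl⟩ := (Q.exact_zero x).1 hx
    exact ⟨y, rfl⟩
  exact_zero := (LinearMap.ker Q.ε).injective_subtype.comp_exact_iff_exact.1 (Q.exact_succ 0)
  exact_succ i := Q.exact_succ (i + 1)

theorem subsingleton_ext_iff {T' : Type*} [Ring T'] (M : Type u) [AddCommGroup M] [Module T M]
    [Module T' M] [SMulCommClass T T' M] (i : ℕ) :
    Subsingleton (Abelian.Ext (ModuleCat.of T X) (ModuleCat.of T M) (i + 1)) ↔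
      Function.Exact (LinearMap.lcomp T' M (Q.d i)) (LinearMap.lcomp T' M (Q.d (i + 1))) := by
  have hQ {X : Type u} [AddCommGroup X] [Module T X] (Q : ProjRes T X) :
      Projective Q.ε.shortComplexKer.X₂ := (IsProjective.iff_projective _).1 (Q.projective 0)
  induction i generalizing X with
  | zero =>
    have := hQ Q
    refine (subsingleton_ext_one_iff (Q.ε.shortExact_shortComplexKer Q.surjective) _).trans ?_
    constructor
    · intro h f
      constructor
      · intro hf
        obtain ⟨k, rfl⟩ := (lcomp_exact_of_surjective Q.shift.exact_zero Q.shift.surjective f).1 hf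
        obtain ⟨g, hg⟩ := h (ModuleCat.ofHom k)
        exact ⟨g.hom, LinearMap.ext fun p =>
          LinearMap.congr_fun (congrArg ModuleCat.Hom.hom hg) (Q.shift.ε p)⟩
      · rintro ⟨g, rfl⟩
        exact LinearMap.ext fun p => by simp [(Q.exact_succ 0).apply_apply_eq_zero]
    · intro h f
      obtain ⟨g, hg⟩ := (h (f.hom.comp Q.shift.ε)).1
        ((lcomp_exact_of_surjective (T' := T') Q.shift.exact_zero Q.shift.surjective _).2 ⟨_, rfl⟩)
      refine ⟨ModuleCat.ofHom g, ModuleCat.hom_ext ?_⟩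
      exact (LinearMap.cancel_right Q.shift.surjective).1 hg
  | succ i ih =>
    have := hQ Q
    exact (subsingleton_ext_succ_iff (Q.ε.shortExact_shortComplexKer Q.surjective) _ i).trans
      (ih Q.shift)

theorem isExtAcyclic_iff {T' : Type*} [Ring T'] (M : Type u) [AddCommGroup M] [Module T M]
    [Module T' M] [SMulCommClass T T' M] :
    IsExtAcyclic (ModuleCat.of T X) (ModuleCat.of T M) ↔
      ∀ i, Function.Exact (LinearMap.lcomp T' M (Q.d i)) (LinearMap.lcomp T' M (Q.d (i + 1))) := by
  simp only [← Q.subsingleton_ext_iff (T' := T') M]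
  exact ⟨fun h i => h _ (by omega), fun h i hi => by
    obtain ⟨i, rfl⟩ := Nat.exists_eq_add_of_le' hi
    exact h i⟩

end ProjRes

theorem HasDegreewiseFiniteProjRes.exists_projRes {T : Type u} [Ring T] {X : Type u}
    [AddCommGroup X] [Module T X] (h : HasDegreewiseFiniteProjRes T X) :
    ∃ Q : ProjRes T X, Q.DegreewiseFinite := by
  obtain ⟨P, d, ε, hP, hε, hdε, hd⟩ := h
  exact ⟨⟨P, d, ε, fun i => (hP i).2, hε, hdε, hd⟩, ⟨fun i => (hP i).1⟩⟩

/-! ### Vanishing of Tor -/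

namespace BTensor

variable (S : Type u) [Ring S]

theorem rTensor_rTensor_eq_zero {A B C N : Type u} [AddCommGroup A] [Module Sᵐᵒᵖ A]
    [AddCommGroup B] [Module Sᵐᵒᵖ B] [AddCommGroup C] [Module Sᵐᵒᵖ C] [AddCommGroup N] [Module S N]
    {f : A →ₗ[Sᵐᵒᵖ] B} {g : B →ₗ[Sᵐᵒᵖ] C} (h : g.comp f = 0) (t : BTensor S A N) :
    rTensor S N g (rTensor S N f t) = 0 := by
  rw [rTensor_rTensor, h]
  induction t using induction_on with
  | zero => rw [map_zero]
  | tmul x n => simp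
  | add t t' h h' => rw [map_add, h, h', add_zero]

theorem lMap_lMap_eq_zero {A N N' N'' : Type u} [AddCommGroup A] [Module Sᵐᵒᵖ A]
    [AddCommGroup N] [Module S N] [AddCommGroup N'] [Module S N'] [AddCommGroup N''] [Module S N'']
    {f : N →ₗ[S] N'} {g : N' →ₗ[S] N''} (h : g.comp f = 0) (t : BTensor S A N) :
    lMap S A g (lMap S A f t) = 0 := by
  rw [lMap_lMap, h]
  induction t using induction_on with
  | zero => rw [map_zero]
  | tmul x n => simp
  | add t t' h h' => rw [map_add, h, h', add_zero]

section Chase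

variable {S} {W₀ W₁ W₂ W₃ : Type u} [AddCommGroup W₀] [Module Sᵐᵒᵖ W₀] [AddCommGroup W₁]
  [Module Sᵐᵒᵖ W₁] [AddCommGroup W₂] [Module Sᵐᵒᵖ W₂] [AddCommGroup W₃] [Module Sᵐᵒᵖ W₃]
  {δ₁ : W₁ →ₗ[Sᵐᵒᵖ] W₀} {δ₂ : W₂ →ₗ[Sᵐᵒᵖ] W₁} {δ₃ : W₃ →ₗ[Sᵐᵒᵖ] W₂}
  {A B C : Type u} [AddCommGroup A] [Module S A] [AddCommGroup B] [Module S B]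
  [AddCommGroup C] [Module S C] {f : A →ₗ[S] B} {g : B →ₗ[S] C}

theorem rTensor_exact_quotient (hfg : Function.Exact f g) (hg : Function.Surjective g)
    (h₁₂ : δ₁.comp δ₂ = 0) (h₂₃ : δ₂.comp δ₃ = 0) (hf : Function.Injective (lMap S W₀ f))
    (hA : Function.Exact (rTensor S A δ₂) (rTensor S A δ₁))
    (hB : Function.Exact (rTensor S B δ₃) (rTensor S B δ₂)) :
    Function.Exact (rTensor S C δ₃) (rTensor S C δ₂) := by
  intro z
  refine ⟨fun hz => ?_, ?_⟩
  · obtain ⟨y, rfl⟩ := lMap_surjective S hg z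
    obtain ⟨x, hx⟩ := (lMap_exact S hfg hg (rTensor S B δ₂ y)).1 (by rw [lMap_rTensor, hz])
    obtain ⟨x', rfl⟩ := (hA x).1 (hf (by
      rw [lMap_rTensor, hx, rTensor_rTensor_eq_zero S h₁₂, map_zero]))
    obtain ⟨y', hy'⟩ := (hB (y - lMap S W₂ f x')).1
      (by rw [map_sub, ← lMap_rTensor, hx, sub_self])
    refine ⟨lMap S W₃ g y', ?_⟩
    rw [← lMap_rTensor, hy', map_sub, (lMap_exact S hfg hg).apply_apply_eq_zero, sub_zero]
  · rintro ⟨y, rfl⟩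
    exact rTensor_rTensor_eq_zero S h₂₃ y

theorem exists_rTensor_lMap_eq (hfg : Function.Exact f g) (hg : Function.Surjective g)
    (h₂₃ : δ₂.comp δ₃ = 0) (hC : Function.Exact (rTensor S C δ₃) (rTensor S C δ₂))
    (y : BTensor S W₂ B) (hy : lMap S W₁ g (rTensor S B δ₂ y) = 0) :
    ∃ x : BTensor S W₂ A, lMap S W₁ f (rTensor S A δ₂ x) = rTensor S B δ₂ y := by
  obtain ⟨z, hz⟩ := (hC (lMap S W₂ g y)).1 (by rw [← lMap_rTensor, hy])
  obtain ⟨y', rfl⟩ := lMap_surjective S hg z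
  obtain ⟨x, hx⟩ := (lMap_exact S hfg hg (y - rTensor S B δ₃ y')).1
    (by rw [map_sub, ← hz, lMap_rTensor, sub_self])
  exact ⟨x, by rw [lMap_rTensor, hx, map_sub, rTensor_rTensor_eq_zero S h₂₃, sub_zero]⟩

theorem rTensor_exact_sub (hfg : Function.Exact f g) (hg : Function.Surjective g)
    (h₁₂ : δ₁.comp δ₂ = 0) (h₂₃ : δ₂.comp δ₃ = 0) (hf : Function.Injective (lMap S W₁ f))
    (hB : Function.Exact (rTensor S B δ₂) (rTensor S B δ₁))
    (hC : Function.Exact (rTensor S C δ₃) (rTensor S C δ₂)) :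
    Function.Exact (rTensor S A δ₂) (rTensor S A δ₁) := by
  intro x
  refine ⟨fun hx => ?_, ?_⟩
  · obtain ⟨y, hy⟩ := (hB (lMap S W₁ f x)).1 (by rw [← lMap_rTensor, hx, map_zero])
    obtain ⟨x', hx'⟩ := exists_rTensor_lMap_eq hfg hg h₂₃ hC y
      (by rw [hy, (lMap_exact S hfg hg).apply_apply_eq_zero])
    exact ⟨x', hf (hx'.trans hy)⟩
  · rintro ⟨y, rfl⟩
    exact rTensor_rTensor_eq_zero S h₁₂ y

theorem lMap_injective_of_exact (hfg : Function.Exact f g) (hg : Function.Surjective g)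
    (hδ : Function.Surjective δ₁) (h₁₂ : Function.Exact δ₂ δ₁) (h₂₃ : δ₂.comp δ₃ = 0)
    (hf : Function.Injective (lMap S W₁ f))
    (hC : Function.Exact (rTensor S C δ₃) (rTensor S C δ₂)) :
    Function.Injective (lMap S W₀ f) := by
  refine (injective_iff_map_eq_zero _).2 fun x hx => ?_
  obtain ⟨x, rfl⟩ := rTensor_surjective S hδ x
  obtain ⟨y, hy⟩ := (BTensor.rTensor_exact S h₁₂ hδ (lMap S W₁ f x)).1 (by rw [← lMap_rTensor, hx])
  obtain ⟨x', hx'⟩ := exists_rTensor_lMap_eq hfg hg h₂₃ hC y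
    (by rw [hy, (lMap_exact S hfg hg).apply_apply_eq_zero])
  rw [← hf (hx'.trans hy)]
  exact rTensor_rTensor_eq_zero S h₁₂.linearMap_comp_eq_zero x'

end Chase

end BTensor

namespace ProjRes

open BTensor

variable {S : Type u} [Ring S] {X : Type u} [AddCommGroup X] [Module Sᵐᵒᵖ X] (Q : ProjRes Sᵐᵒᵖ X)

/-- `Torᵢ₊₁(X, N) = 0`, expressed by the complex `P ⊗_S N`. -/
def TorVanishes (i : ℕ) (N : Type u) [AddCommGroup N] [Module S N] : Prop :=
  Function.Exact (rTensor S N (Q.d (i + 1))) (rTensor S N (Q.d i))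

theorem torVanishes_of_isFlat (i : ℕ) {N : Type u} [AddCommGroup N] [Module S N]
    (hN : IsFlat S N) : Q.TorVanishes i N :=
  hN.exact (Q.exact_succ i)

variable {A B C : Type u} [AddCommGroup A] [Module S A] [AddCommGroup B] [Module S B]
  [AddCommGroup C] [Module S C] {f : A →ₗ[S] B} {g : B →ₗ[S] C} {Q}

theorem TorVanishes.of_equiv {i : ℕ} (e : A ≃ₗ[S] B) (hA : Q.TorVanishes i A) :
    Q.TorVanishes i B :=
  Function.Exact.of_ladder_addEquiv_of_exact (lCongr S _ e) (lCongr S _ e) (lCongr S _ e)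
    (AddMonoidHom.ext fun t => (lMap_rTensor S _ _ t).symm)
    (AddMonoidHom.ext fun t => (lMap_rTensor S _ _ t).symm) hA

theorem TorVanishes.of_exact {i : ℕ} (hf : Function.Injective f) (hfg : Function.Exact f g)
    (hg : Function.Surjective g) (hB : Q.TorVanishes i B) (hC : Q.TorVanishes (i + 1) C) :
    Q.TorVanishes i A :=
  rTensor_exact_sub hfg hg (Q.exact_succ i).linearMap_comp_eq_zero
    (Q.exact_succ (i + 1)).linearMap_comp_eq_zero (BTensor.lMap_injective S hf) hB hC

theorem TorVanishes.lMap_injective (hf : Function.Injective f) (hfg : Function.Exact f g)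
    (hg : Function.Surjective g) (hC : Q.TorVanishes 0 C) : Function.Injective (lMap S X f) :=
  lMap_injective_of_exact hfg hg Q.surjective Q.exact_zero
    (Q.exact_succ 0).linearMap_comp_eq_zero (BTensor.lMap_injective S hf) hC

variable (Q)

theorem torVanishes_of_exact_lMap (i : ℕ) {N : Type u} [AddCommGroup N] [Module S N]
    (W : ProjRes S N) (h : Function.Exact (lMap S X (W.d (i + 1))) (lMap S X (W.d i))) :
    Q.TorVanishes i N := by
  induction i generalizing N with
  | zero =>
    refine rTensor_exact_quotient W.ε.exact_subtype_ker_map W.surjective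
      Q.exact_zero.linearMap_comp_eq_zero (Q.exact_succ 0).linearMap_comp_eq_zero
      ((injective_iff_map_eq_zero _).2 fun t ht => ?_)
      (BTensor.rTensor_exact S Q.exact_zero Q.surjective)
      (Q.torVanishes_of_isFlat 0 (IsFlat.of_projective _))
    obtain ⟨t, rfl⟩ := lMap_surjective S W.shift.surjective t
    have hd : (LinearMap.ker W.ε).subtype.comp W.shift.ε = W.d 0 := rfl
    rw [lMap_lMap, hd] at ht
    obtain ⟨u, rfl⟩ := (h t).1 ht
    exact lMap_lMap_eq_zero S W.shift.exact_zero.linearMap_comp_eq_zero u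
  | succ i ih =>
    exact rTensor_exact_quotient W.ε.exact_subtype_ker_map W.surjective
      (Q.exact_succ i).linearMap_comp_eq_zero (Q.exact_succ (i + 1)).linearMap_comp_eq_zero
      (BTensor.lMap_injective S (Submodule.subtype_injective _)) (ih W.shift h)
      (Q.torVanishes_of_isFlat (i + 1) (IsFlat.of_projective _))

/-- The sequence of modules underlying a categorical projective resolution. -/
def ofProjectiveResolution {T : Type u} [Ring T] {N : ModuleCat.{u} T}
    (W : ProjectiveResolution N) : ProjRes T N where
  P := W.complex.X
  d i := (W.complex.d (i + 1) i).hom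
  ε := (W.π.f 0).hom
  projective i := (IsProjective.iff_projective _).2 (W.projective i)
  surjective := (ModuleCat.epi_iff_surjective (W.π.f 0)).1 inferInstance
  exact_zero := (ShortComplex.ShortExact.moduleCat_exact_iff_function_exact _).1 <|
    ShortComplex.exact_of_g_is_cokernel
      (ShortComplex.mk _ _ W.complex_d_comp_π_f_zero) W.isColimitCokernelCofork
  exact_succ i := (ShortComplex.ShortExact.moduleCat_exact_iff_function_exact _).1 (W.exact_succ i)

theorem torVanishes_of_isZero_tor {R : Type u} [Ring R] [Module R X] [SMulCommClass R Sᵐᵒᵖ X]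
    {i : ℕ} {N : ModuleCat.{u} S} (h : Limits.IsZero (tor R S X (i + 1) N)) :
    Q.TorVanishes i N := by
  let W := projectiveResolution N
  refine Q.torVanishes_of_exact_lMap i (ofProjectiveResolution W) ?_
  have h₁ := h.of_iso (W.isoLeftDerivedObj (tensorFunctor R S X) (i + 1)).symm
  have h₂ := (HomologicalComplex.exactAt_iff_isZero_homology _ _).2 h₁
  rw [HomologicalComplex.exactAt_iff' _ (i + 2) (i + 1) i (by simp) (by simp)] at h₂
  exact (ShortComplex.ShortExact.moduleCat_exact_iff_function_exact _).1 h₂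

end ProjRes

/-! ### Resolutions of finite length -/

section Resolution

variable {T : Type u} [Ring T] {𝒳 : ModuleCat.{u} T → Prop} {M M' : ModuleCat.{u} T} {n : ℕ}

theorem HasResolution.of_equiv (e : M ≃ₗ[T] M') (h : HasResolution 𝒳 M n) :
    HasResolution 𝒳 M' n := by
  obtain ⟨X, d, ε, hX, hX₀, hε, hdε, hd⟩ := h
  exact ⟨X, d, e.toLinearMap.comp ε, hX, hX₀, e.surjective.comp hε,
    hdε.comp_injective e e.injective (map_zero e), hd⟩

theorem HasCoresolution.of_equiv (e : M ≃ₗ[T] M') (h : HasCoresolution 𝒳 M n) :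
    HasCoresolution 𝒳 M' n := by
  obtain ⟨X, d, η, hX, hX₀, hη, hηd, hd⟩ := h
  exact ⟨X, d, η.comp e.symm.toLinearMap, hX, hX₀, hη.comp e.symm.injective,
    e.symm.surjective.comp_exact_iff_exact.2 hηd, hd⟩

theorem hasResolution_zero_iff :
    HasResolution 𝒳 M 0 ↔ ∃ X : ModuleCat.{u} T, 𝒳 X ∧ Nonempty (X ≃ₗ[T] M) := by
  constructor
  · rintro ⟨X, d, ε, hX, hX₀, hε, hdε, -⟩
    have := hX₀ 1 one_pos
    rw [Subsingleton.elim (d 0) 0] at hdε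
    exact ⟨X 0, hX 0 le_rfl,
      ⟨LinearEquiv.ofBijective ε ⟨(LinearMap.exact_zero_iff_injective _ ε).1 hdε, hε⟩⟩⟩
  · rintro ⟨X, hX, ⟨e⟩⟩
    refine ⟨fun i => Nat.casesOn i X fun _ => ModuleCat.of T PUnit, fun i => 0, e.toLinearMap,
      ?_, ?_, e.surjective, (LinearMap.exact_zero_iff_injective _ _).2 e.injective, fun i x => ?_⟩
    · intro i hi
      obtain rfl : i = 0 := by omega
      exact hX
    · rintro (_ | i) hi
      · exact absurd hi (lt_irrefl _)
      · exact inferInstanceAs (Subsingleton PUnit)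
    · exact ⟨fun _ => ⟨0, Subsingleton.elim (α := PUnit) _ _⟩, fun _ => rfl⟩

theorem hasCoresolution_zero_iff :
    HasCoresolution 𝒳 M 0 ↔ ∃ X : ModuleCat.{u} T, 𝒳 X ∧ Nonempty (X ≃ₗ[T] M) := by
  constructor
  · rintro ⟨X, d, η, hX, hX₀, hη, hηd, -⟩
    have := hX₀ 1 one_pos
    rw [Subsingleton.elim (d 0) 0] at hηd
    exact ⟨X 0, hX 0 le_rfl,
      ⟨(LinearEquiv.ofBijective η ⟨hη, (LinearMap.exact_zero_iff_surjective _ η).1 hηd⟩).symm⟩⟩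
  · rintro ⟨X, hX, ⟨e⟩⟩
    refine ⟨fun i => Nat.casesOn i X fun _ => ModuleCat.of T PUnit, fun i => 0,
      e.symm.toLinearMap, ?_, ?_, e.symm.injective,
      (LinearMap.exact_zero_iff_surjective _ _).2 e.symm.surjective, fun i x => ?_⟩
    · intro i hi
      obtain rfl : i = 0 := by omega
      exact hX
    · rintro (_ | i) hi
      · exact absurd hi (lt_irrefl _)
      · exact inferInstanceAs (Subsingleton PUnit)
    · exact ⟨fun _ => ⟨0, Subsingleton.elim (α := PUnit) _ _⟩, fun _ => rfl⟩

theorem hasResolution_succ_iff :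
    HasResolution 𝒳 M (n + 1) ↔ ∃ (K X : ModuleCat.{u} T) (f : K →ₗ[T] X) (g : X →ₗ[T] M),
      𝒳 X ∧ HasResolution 𝒳 K n ∧ Function.Injective f ∧ Function.Exact f g ∧
        Function.Surjective g := by
  constructor
  · rintro ⟨X, d, ε, hX, hX₀, hε, hdε, hd⟩
    refine ⟨ModuleCat.of T (LinearMap.ker ε), X 0, (LinearMap.ker ε).subtype, ε,
      hX 0 (Nat.zero_le _), ⟨fun i => X (i + 1), fun i => d (i + 1),
        (d 0).codRestrict _ hdε.apply_apply_eq_zero, fun i hi => hX _ (Nat.succ_le_succ hi),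
        fun i hi => hX₀ _ (Nat.succ_lt_succ hi), ?_, ?_, fun i => hd (i + 1)⟩,
      Submodule.subtype_injective _, ε.exact_subtype_ker_map, hε⟩
    · rintro ⟨x, hx⟩
      obtain ⟨y, rfl⟩ := (hdε x).1 hx
      exact ⟨y, rfl⟩
    · exact (LinearMap.ker ε).injective_subtype.comp_exact_iff_exact.1 (hd 0)
  · rintro ⟨K, X, f, g, hX, ⟨Y, d, ε, hY, hY₀, hε, hdε, hd⟩, hf, hfg, hg⟩
    refine ⟨fun i => Nat.casesOn i X Y, fun i => match i with
      | 0 => f.comp ε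
      | i + 1 => d i, g, ?_, ?_, hg, hε.comp_exact_iff_exact.2 hfg, ?_⟩
    · rintro (_ | i) hi
      · exact hX
      · exact hY i (Nat.le_of_succ_le_succ hi)
    · rintro (_ | i) hi
      · exact absurd hi (Nat.not_lt_zero _)
      · exact hY₀ i (Nat.lt_of_succ_lt_succ hi)
    · rintro (_ | i)
      · exact hdε.comp_injective f hf (map_zero f)
      · exact hd i

theorem hasCoresolution_succ_iff :
    HasCoresolution 𝒳 M (n + 1) ↔ ∃ (X K : ModuleCat.{u} T) (f : M →ₗ[T] X) (g : X →ₗ[T] K),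
      𝒳 X ∧ HasCoresolution 𝒳 K n ∧ Function.Injective f ∧ Function.Exact f g ∧
        Function.Surjective g := by
  constructor
  · rintro ⟨X, d, η, hX, hX₀, hη, hηd, hd⟩
    refine ⟨X 0, ModuleCat.of T (LinearMap.range (d 0)), η, (d 0).rangeRestrict,
      hX 0 (Nat.zero_le _), ⟨fun i => X (i + 1), fun i => d (i + 1),
        (LinearMap.range (d 0)).subtype, fun i hi => hX _ (Nat.succ_le_succ hi),
        fun i hi => hX₀ _ (Nat.succ_lt_succ hi), Submodule.subtype_injective _, ?_,
        fun i => hd (i + 1)⟩, hη, exact_rangeRestrict hηd, (d 0).surjective_rangeRestrict⟩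
    exact (d 0).surjective_rangeRestrict.comp_exact_iff_exact.1 (hd 0)
  · rintro ⟨X, K, f, g, hX, ⟨Y, d, η, hY, hY₀, hη, hηd, hd⟩, hf, hfg, hg⟩
    refine ⟨fun i => Nat.casesOn i X Y, fun i => match i with
      | 0 => η.comp g
      | i + 1 => d i, f, ?_, ?_, hf, hfg.comp_injective η hη (map_zero η), ?_⟩
    · rintro (_ | i) hi
      · exact hX
      · exact hY i (Nat.le_of_succ_le_succ hi)
    · rintro (_ | i) hi
      · exact absurd hi (Nat.not_lt_zero _)
      · exact hY₀ i (Nat.lt_of_succ_lt_succ hi)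
    · rintro (_ | i)
      · exact hg.comp_exact_iff_exact.2 hηd
      · exact hd i

theorem hasResolution_projective_iff :
    HasResolution (fun P : ModuleCat.{u} T => Module.Projective T P) M n ↔
      HasProjectiveDimensionLT M (n + 1) := by
  induction n generalizing M with
  | zero =>
    rw [hasResolution_zero_iff, zero_add, ← projective_iff_hasProjectiveDimensionLT_one]
    constructor
    · rintro ⟨X, hX, ⟨e⟩⟩
      exact (IsProjective.iff_projective _).1 (Module.Projective.of_equiv' e)
    · exact fun h => ⟨M, (IsProjective.iff_projective _).2 h, ⟨LinearEquiv.refl T M⟩⟩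
  | succ n ih =>
    rw [hasResolution_succ_iff]
    constructor
    · rintro ⟨K, X, f, g, hX, hK, hf, hfg, hg⟩
      exact ((shortExact_of_exact hf hfg hg).hasProjectiveDimensionLT_X₃_iff n
        ((IsProjective.iff_projective _).1 hX)).2 (ih.1 hK)
    · intro h
      have h𝒮 := M.shortExact_projectiveShortComplex
      have hP : Module.Projective T M.projectiveShortComplex.X₂ := Module.Projective.of_free
      exact ⟨_, _, M.projectiveShortComplex.f.hom, M.projectiveShortComplex.g.hom, hP,
        ih.2 ((h𝒮.hasProjectiveDimensionLT_X₃_iff n ((IsProjective.iff_projective _).1 hP)).1 h),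
        (ModuleCat.mono_iff_injective _).1 h𝒮.mono_f,
        (ShortComplex.ShortExact.moduleCat_exact_iff_function_exact _).1 h𝒮.exact,
        (ModuleCat.epi_iff_surjective _).1 h𝒮.epi_g⟩

theorem hasCoresolution_injective_iff :
    HasCoresolution (fun I : ModuleCat.{u} T => Module.Injective T I) M n ↔
      HasInjectiveDimensionLT M (n + 1) := by
  induction n generalizing M with
  | zero =>
    rw [hasCoresolution_zero_iff, zero_add, ← injective_iff_hasInjectiveDimensionLT_one]
    constructor
    · rintro ⟨X, hX, ⟨e⟩⟩
      exact Injective.of_iso e.toModuleIso ((Module.injective_iff_injective_object T X).1 hX)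
    · exact fun h => ⟨M, (Module.injective_iff_injective_object T M).2 h, ⟨LinearEquiv.refl T M⟩⟩
  | succ n ih =>
    rw [hasCoresolution_succ_iff]
    constructor
    · rintro ⟨X, K, f, g, hX, hK, hf, hfg, hg⟩
      exact ((shortExact_of_exact hf hfg hg).hasInjectiveDimensionLT_X₃_iff n
        ((Module.injective_iff_injective_object T X).1 hX)).1 (ih.1 hK)
    · intro h
      let ι := (Injective.ι M).hom
      have hι : Function.Injective ι :=
        (ModuleCat.mono_iff_injective (Injective.ι M)).1 inferInstance
      have hιq : Function.Exact ι (LinearMap.range ι).mkQ := ι.exact_map_mkQ_range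
      have hq := (LinearMap.range ι).mkQ_surjective
      have h𝒮 := shortExact_of_exact (C := ModuleCat.of T (_ ⧸ LinearMap.range ι)) hι hιq hq
      exact ⟨_, _, ι, (LinearMap.range ι).mkQ,
        (Module.injective_iff_injective_object T _).2 (Injective.injective_under M),
        ih.2 ((h𝒮.hasInjectiveDimensionLT_X₃_iff n (Injective.injective_under M)).2 h), hι, hιq, hq⟩

theorem relProjDim_le_of_forall {U : Type u} [Ring U] {𝒴 : ModuleCat.{u} U → Prop}
    {N : ModuleCat.{u} U} (h : ∀ n, HasResolution 𝒴 N n → HasResolution 𝒳 M n) :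
    relProjDim 𝒳 M ≤ relProjDim 𝒴 N :=
  le_iInf₂ fun n hn => iInf₂_le n (h n hn)

theorem relInjDim_le_of_forall {U : Type u} [Ring U] {𝒴 : ModuleCat.{u} U → Prop}
    {N : ModuleCat.{u} U} (h : ∀ n, HasCoresolution 𝒴 N n → HasCoresolution 𝒳 M n) :
    relInjDim 𝒳 M ≤ relInjDim 𝒴 N :=
  le_iInf₂ fun n hn => iInf₂_le n (h n hn)

theorem unbotD_zero_le_natCast_iff {a : WithBot ℕ∞} {n : ℕ} :
    a.unbotD 0 ≤ (n : ℕ∞) ↔ a ≤ (n : WithBot ℕ∞) := by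
  induction a with
  | bot => simp
  | coe a => exact_mod_cast Iff.rfl

theorem eq_iInf_natCast {a : ℕ∞} {p : ℕ → Prop} (h : ∀ n : ℕ, p n ↔ a ≤ n) :
    a = ⨅ (n : ℕ) (_ : p n), (n : ℕ∞) := by
  refine le_antisymm (le_iInf₂ fun n hn => (h n).1 hn) ?_
  induction a with
  | top => exact le_top
  | coe a => exact iInf₂_le a ((h a).2 le_rfl)

theorem projDim_eq_relProjDim (M : ModuleCat.{u} T) :
    projDim M = relProjDim (fun P : ModuleCat.{u} T => Module.Projective T P) M :=
  eq_iInf_natCast fun n => hasResolution_projective_iff.trans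
    ((projectiveDimension_le_iff M n).symm.trans unbotD_zero_le_natCast_iff.symm)

theorem injDim_eq_relInjDim (M : ModuleCat.{u} T) :
    injDim M = relInjDim (fun I : ModuleCat.{u} T => Module.Injective T I) M :=
  eq_iInf_natCast fun n => hasCoresolution_injective_iff.trans
    ((injectiveDimension_le_iff M n).symm.trans unbotD_zero_le_natCast_iff.symm)

end Resolution

/-! ### Evaluation maps over finitely generated projectives -/

open BTensor

section DualBasis

theorem exists_finite_dual_basis (T M : Type*) [Ring T] [AddCommGroup M] [Module T M]
    [Module.Finite T M] [Module.Projective T M] :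
    ∃ (n : ℕ) (x : Fin n → M) (φ : Fin n → M →ₗ[T] T), ∀ m, ∑ i, φ i m • x i = m := by
  obtain ⟨n, f, g, -, -, hfg⟩ := Module.Finite.exists_comp_eq_id_of_projective T M
  refine ⟨n, fun i => f (Pi.single i 1), fun i => (LinearMap.proj i).comp g, fun m => ?_⟩
  have hm : f (g m) = m := LinearMap.congr_fun hfg m
  conv_rhs => rw [← hm, ← Finset.univ_sum_single (g m), map_sum]
  exact Finset.sum_congr rfl fun i _ => by simp [← map_smul, ← Pi.single_smul]

variable {T T' : Type*} [Ring T] [Ring T'] {P M : Type*} [AddCommGroup P] [Module T P]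
  [AddCommGroup M] [Module T M] [Module T' M] [SMulCommClass T T' M]

variable (T' M) in
/-- The `T'`-linear map `m ↦ (p ↦ φ(p) m)` for a functional `φ`; Mathlib's `LinearMap.smulRightₗ`
is only available over a commutative ring. -/
def smulRightHom (φ : P →ₗ[T] T) : M →ₗ[T'] P →ₗ[T] M where
  toFun m := φ.smulRight m
  map_add' m m' := LinearMap.ext fun p => smul_add (φ p) m m'
  map_smul' t m := LinearMap.ext fun p => smul_comm (φ p) t m

@[simp] theorem smulRightHom_apply (φ : P →ₗ[T] T) (m : M) (p : P) :
    smulRightHom T' M φ m p = φ p • m :=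
  rfl

theorem sum_smulRightHom_apply {n : ℕ} {x : Fin n → P} {φ : Fin n → P →ₗ[T] T}
    (h : ∀ p, ∑ i, φ i p • x i = p) (f : P →ₗ[T] M) :
    ∑ i, smulRightHom T' M (φ i) (f (x i)) = f := by
  ext p
  conv_rhs => rw [← h p, map_sum]
  simp

end DualBasis

section DoubleCentralizer

variable {R T X : Type u} [Ring R] [Ring T] [AddCommGroup X] [Module R X] [Module T X]
  [SMulCommClass R T X] (Q : ProjRes R X)

theorem ProjRes.toSpanSingleton_ε_injective [FaithfulSMul T X] :
    Function.Injective (LinearMap.toSpanSingleton T (Q.P 0 →ₗ[R] X) Q.ε) := fun t t' h =>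
  FaithfulSMul.eq_of_smul_eq_smul fun x => by
    obtain ⟨p, rfl⟩ := Q.surjective x
    exact LinearMap.congr_fun h p

theorem ProjRes.exact_toSpanSingleton_ε (h : ∀ f : X →ₗ[R] X, ∃ t : T, ∀ x, t • x = f x) :
    Function.Exact (LinearMap.toSpanSingleton T (Q.P 0 →ₗ[R] X) Q.ε)
      (LinearMap.lcomp T X (Q.d 0)) := by
  intro f
  rw [lcomp_exact_of_surjective Q.exact_zero Q.surjective f]
  constructor
  · rintro ⟨g, rfl⟩
    obtain ⟨t, ht⟩ := h g
    exact ⟨t, LinearMap.ext fun p => ht (Q.ε p)⟩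
  · rintro ⟨t, rfl⟩
    have := SMulCommClass.symm R T X
    exact ⟨Module.toModuleEnd R X t, rfl⟩

end DoubleCentralizer

namespace BTensor

variable {S F : Type u} [Ring S] [AddCommGroup F] [Module S F]

theorem tmul_one_contract (t : BTensor S Sᵐᵒᵖ F) :
    tmul S (1 : Sᵐᵒᵖ) (contract S LinearMap.id t) = t := by
  induction t using induction_on with
  | zero => simp
  | tmul a y => rw [contract_tmul, ← smul_tmul]; simp
  | add t t' h h' => rw [map_add, tmul_add, h, h']

variable {A B : Type u} [AddCommGroup A] [Module Sᵐᵒᵖ A] [AddCommGroup B] [Module Sᵐᵒᵖ B]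

variable (S F) in
/-- The homomorphism `y ↦ a ⊗ y`. -/
def tmulLeft (a : A) : F →+ BTensor S A F :=
  AddMonoidHom.mk' (tmul S a) (tmul_add S a)

@[simp] theorem tmulLeft_apply (a : A) (y : F) : tmulLeft S F a y = tmul S a y :=
  rfl

theorem rTensor_toSpanSingleton (a : A) (t : BTensor S Sᵐᵒᵖ F) :
    rTensor S F (LinearMap.toSpanSingleton Sᵐᵒᵖ A a) t = tmul S a (contract S LinearMap.id t) := by
  conv_lhs => rw [← tmul_one_contract t]
  simp

end BTensor

theorem IsFlat.tmulLeft_injective {S F : Type u} [Ring S] [AddCommGroup F] [Module S F]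
    (hF : IsFlat S F) {A : Type u} [AddCommGroup A] [Module Sᵐᵒᵖ A] {a : A}
    (ha : Function.Injective (LinearMap.toSpanSingleton Sᵐᵒᵖ A a)) :
    Function.Injective (tmulLeft S F a) := fun y y' h => by
  have := hF _ _ _ ha (a₁ := tmul S 1 y) (a₂ := tmul S 1 y') (by simpa using h)
  simpa using congrArg (contract S LinearMap.id) this

theorem IsFlat.tmulLeft_exact {S F : Type u} [Ring S] [AddCommGroup F] [Module S F]
    (hF : IsFlat S F) {A B : Type u} [AddCommGroup A] [Module Sᵐᵒᵖ A] [AddCommGroup B]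
    [Module Sᵐᵒᵖ B] {a : A} {g : A →ₗ[Sᵐᵒᵖ] B}
    (h : Function.Exact (LinearMap.toSpanSingleton Sᵐᵒᵖ A a) g) :
    Function.Exact (tmulLeft S F a) (rTensor S F g) := by
  intro t
  rw [hF.exact h t]
  constructor
  · rintro ⟨s, rfl⟩
    exact ⟨contract S LinearMap.id s, (rTensor_toSpanSingleton a s).symm⟩
  · rintro ⟨y, rfl⟩
    exact ⟨tmul S 1 y, by simp⟩

section Bimodule

variable (R S : Type u) [Ring R] [Ring S] (ω : Type u) [AddCommGroup ω] [Module R ω]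
  [Module Sᵐᵒᵖ ω] [SMulCommClass R Sᵐᵒᵖ ω]

section HomTensor

variable (P F : Type u) [AddCommGroup P] [Module R P] [AddCommGroup F] [Module S F]

/-- Tensor evaluation `Hom_R(P, ω) ⊗_S F → Hom_R(P, ω ⊗_S F)`, `f ⊗ y ↦ (p ↦ f(p) ⊗ y)`. -/
def homTensor : BTensor S (P →ₗ[R] ω) F →+ (P →ₗ[R] BTensor S ω F) :=
  lift S
    (AddMonoidHom.mk' (fun f => AddMonoidHom.mk' (fun y => (tmulRight R S ω y).comp f)
      (fun y y' => LinearMap.ext fun p => tmul_add S (f p) y y'))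
      (fun f f' => by
        ext y p
        exact add_tmul S (f p) (f' p) y))
    (fun f s y => LinearMap.ext fun p => smul_tmul S (f p) s y)

variable {P F}

@[simp] theorem homTensor_tmul (f : P →ₗ[R] ω) (y : F) (p : P) :
    homTensor R S ω P F (tmul S f y) p = tmul S (f p) y :=
  rfl

theorem homTensor_lcomp {P' : Type u} [AddCommGroup P'] [Module R P'] (d : P' →ₗ[R] P)
    (t : BTensor S (P →ₗ[R] ω) F) :
    homTensor R S ω P' F (rTensor S F (LinearMap.lcomp Sᵐᵒᵖ ω d) t) =
      (homTensor R S ω P F t).comp d := by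
  induction t using induction_on with
  | zero => simp
  | tmul f y => rw [rTensor_tmul]; rfl
  | add t t' h h' => simp only [map_add, h, h', LinearMap.add_comp]

theorem homTensor_smulRightHom (φ : P →ₗ[R] R) (t : BTensor S ω F) (p : P) :
    homTensor R S ω P F (rTensor S F (smulRightHom Sᵐᵒᵖ ω φ) t) p = φ p • t := by
  induction t using induction_on with
  | zero => simp
  | tmul w y => simp
  | add t t' h h' => rw [map_add, map_add, LinearMap.add_apply, h, h', smul_add]

theorem homTensor_bijective [Module.Finite R P] [Module.Projective R P] :
    Function.Bijective (homTensor R S ω P F) := by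
  obtain ⟨n, x, φ, h⟩ := exists_finite_dual_basis R P
  refine Function.bijective_iff_has_inverse.2
    ⟨fun k => ∑ i, rTensor S F (smulRightHom Sᵐᵒᵖ ω (φ i)) (k (x i)), fun t => ?_, fun k => ?_⟩
  · dsimp only
    induction t using induction_on with
    | zero => simp
    | tmul f y => simp only [homTensor_tmul, rTensor_tmul, ← sum_tmul, sum_smulRightHom_apply h]
    | add t t' ht ht' =>
      simp only [map_add, LinearMap.add_apply, Finset.sum_add_distrib, ht, ht']
  · ext p
    simp only [map_sum, LinearMap.sum_apply, homTensor_smulRightHom, ← map_smul]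
    rw [← map_sum, h]

end HomTensor

namespace HomFrom

variable {R S ω} {M : Type u} [AddCommGroup M] [Module R M]

/-- The linear map underlying an element of `M_*`. -/
abbrev hom (f : HomFrom R S ω M) : ω →ₗ[R] M :=
  f

end HomFrom

section TensorHom

variable [SMulCommClass Sᵐᵒᵖ R ω] (P I : Type u) [AddCommGroup P] [Module Sᵐᵒᵖ P] [AddCommGroup I]
  [Module R I]

variable {P} in
/-- Evaluation at `p`, an `R`-linear map `Hom_{Sᵒᵖ}(P, ω) → ω`. -/
def evalAt (p : P) : (P →ₗ[Sᵐᵒᵖ] ω) →ₗ[R] ω where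
  toFun h := h p
  map_add' _ _ := rfl
  map_smul' _ _ := rfl

/-- Homomorphism evaluation `P ⊗_S Hom_R(ω, I) → Hom_R(Hom_{Sᵒᵖ}(P, ω), I)`,
`p ⊗ f ↦ (h ↦ f(h(p)))`. -/
def tensorHom : BTensor S P (HomFrom R S ω I) →+ ((P →ₗ[Sᵐᵒᵖ] ω) →ₗ[R] I) :=
  lift S
    (AddMonoidHom.mk' (fun p => AddMonoidHom.mk'
      (fun f : HomFrom R S ω I => f.hom.comp (evalAt R S ω p)) (fun _ _ => rfl))
      (fun p p' => by
        ext f h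
        exact (congrArg f.hom (map_add h p p')).trans (map_add f.hom _ _)))
    (fun p s f => LinearMap.ext fun h => congrArg f.hom (map_smul h (MulOpposite.op s) p))

variable {P I}

theorem tensorHom_rTensor {P' : Type u} [AddCommGroup P'] [Module Sᵐᵒᵖ P'] (d : P' →ₗ[Sᵐᵒᵖ] P)
    (t : BTensor S P' (HomFrom R S ω I)) :
    tensorHom R S ω P I (rTensor S _ d t) =
      (tensorHom R S ω P' I t).comp (LinearMap.lcomp R ω d) := by
  induction t using induction_on with
  | zero => simp
  | tmul p f => rw [rTensor_tmul]; rfl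
  | add t t' h h' => simp only [map_add, h, h', LinearMap.add_comp]

theorem tensorHom_comp_smulRightHom (φ : P →ₗ[Sᵐᵒᵖ] Sᵐᵒᵖ) (t : BTensor S P (HomFrom R S ω I)) :
    (tensorHom R S ω P I t).comp (smulRightHom R ω φ) = (contract S φ t).hom := by
  induction t using induction_on with
  | zero => rw [map_zero, map_zero]; rfl
  | tmul p f => rfl
  | add t t' h h' =>
    rw [map_add, LinearMap.add_comp, h, h', map_add]
    rfl

theorem tensorHom_bijective [Module.Finite Sᵐᵒᵖ P] [Module.Projective Sᵐᵒᵖ P] :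
    Function.Bijective (tensorHom R S ω P I) := by
  obtain ⟨n, x, φ, h⟩ := exists_finite_dual_basis Sᵐᵒᵖ P
  refine Function.bijective_iff_has_inverse.2
    ⟨fun G => ∑ i, tmul S (x i) (G.comp (smulRightHom R ω (φ i)) : HomFrom R S ω I),
      fun t => ?_, fun G => ?_⟩
  · simp only [tensorHom_comp_smulRightHom]
    induction t using induction_on with
    | zero => simp
    | tmul p f =>
      simp only [contract_tmul, ← smul_tmul, MulOpposite.op_unop, ← sum_tmul, h]
    | add t t' ht ht' =>
      simp only [map_add, tmul_add, Finset.sum_add_distrib, ht, ht']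
  · ext k
    rw [map_sum, LinearMap.sum_apply]
    conv_rhs => rw [← sum_smulRightHom_apply (T' := R) h k, map_sum]
    rfl

end TensorHom

/-- The evaluation map `ω ⊗_S Hom_R(ω, M) → M`. -/
def counitMap (M : Type u) [AddCommGroup M] [Module R M] :
    BTensor S ω (HomFrom R S ω M) →ₗ[R] M :=
  let φ : BTensor S ω (HomFrom R S ω M) →+ M := lift S
    (AddMonoidHom.mk' (fun x => AddMonoidHom.mk' (fun f : HomFrom R S ω M => f.hom x)
      (fun _ _ => rfl)) (fun x x' => by ext f; exact map_add f.hom x x'))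
    (fun _ _ _ => rfl)
  { toFun := φ
    map_add' := map_add φ
    map_smul' := fun r t => by
      induction t using induction_on with
      | zero => simp
      | tmul x f => exact map_smul f.hom r x
      | add t t' h h' => rw [smul_add, map_add, map_add, smul_add, h, h'] }

theorem counitMap_naturality {M M' : Type u} [AddCommGroup M] [Module R M] [AddCommGroup M']
    [Module R M'] (f : M →ₗ[R] M') (t : BTensor S ω (HomFrom R S ω M)) :
    counitMap R S ω M' (lMap S ω (HomFrom.map R S ω f) t) = f (counitMap R S ω M t) := by
  induction t using induction_on with
  | zero => simp
  | tmul x g => rfl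
  | add t t' h h' => simp only [map_add, h, h']

theorem counitMap_rTensor [SMulCommClass Sᵐᵒᵖ R ω] {P I : Type u} [AddCommGroup P] [Module Sᵐᵒᵖ P]
    [AddCommGroup I] [Module R I] (ε : P →ₗ[Sᵐᵒᵖ] ω) (t : BTensor S P (HomFrom R S ω I)) :
    counitMap R S ω I (rTensor S _ ε t) = tensorHom R S ω P I t ε := by
  induction t using induction_on with
  | zero => simp
  | tmul p f => rw [rTensor_tmul]; rfl
  | add t t' h h' => simp only [map_add, h, h', LinearMap.add_apply]

end Bimodule

/-! ### Units on flat modules and counits on injective modules -/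

section Dual

variable {R A B I : Type u} [Ring R] [AddCommGroup A] [Module R A] [AddCommGroup B] [Module R B]
  [AddCommGroup I] [Module R I] [Module.Injective R I] {a : A}

theorem apply_surjective_of_injective
    (ha : Function.Injective (LinearMap.toSpanSingleton R A a)) :
    Function.Surjective (LinearMap.applyₗ' ℤ a : (A →ₗ[R] I) →ₗ[ℤ] I) := fun y => by
  obtain ⟨G, hG⟩ := Module.Injective.extension_property R I R A _ ha
    (LinearMap.toSpanSingleton R I y)
  exact ⟨G, by simpa using LinearMap.congr_fun hG 1⟩

theorem lcomp_apply_exact_of_injective {g : A →ₗ[R] B}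
    (h : Function.Exact (LinearMap.toSpanSingleton R A a) g) :
    Function.Exact (LinearMap.lcomp ℤ I g) (LinearMap.applyₗ' ℤ a : (A →ₗ[R] I) →ₗ[ℤ] I) := by
  have hcomp : LinearMap.ringLmapEquivSelf R ℤ I ∘
      LinearMap.lcomp ℤ I (LinearMap.toSpanSingleton R A a) = LinearMap.applyₗ' ℤ a :=
    funext fun G => by simp
  rw [← hcomp]
  exact (lcomp_exact_of_injective (T' := ℤ) h).comp_injective _
    (LinearMap.ringLmapEquivSelf R ℤ I).injective (map_zero _)

end Dual

section Bimodule

variable {R S : Type u} [Ring R] [Ring S] {ω : Type u} [AddCommGroup ω] [Module R ω]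
  [Module Sᵐᵒᵖ ω] [SMulCommClass R Sᵐᵒᵖ ω]

section Flat

variable {X F : Type u} [AddCommGroup X] [Module R X] [AddCommGroup F] [Module S F]

theorem IsExtAcyclic.tensor_of_isFlat (P : ProjRes R X) [P.DegreewiseFinite]
    (h : IsExtAcyclic (ModuleCat.of R X) (ModuleCat.of R ω)) (hF : IsFlat S F) :
    IsExtAcyclic (ModuleCat.of R X) (ModuleCat.of R (BTensor S ω F)) :=
  (P.isExtAcyclic_iff (T' := ℤ) _).2 fun i =>
    let e (j : ℕ) := AddEquiv.ofBijective _ (homTensor_bijective R S ω (P := P.P j) (F := F))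
    let δ (j : ℕ) := (LinearMap.lcomp ℤ (BTensor S ω F) (P.d j)).toAddMonoidHom
    Function.Exact.of_ladder_addEquiv_of_exact (g₁₂ := δ i) (g₂₃ := δ (i + 1))
      (e i) (e (i + 1)) (e (i + 2))
      (AddMonoidHom.ext fun t => (homTensor_lcomp R S ω (P.d i) t).symm)
      (AddMonoidHom.ext fun t => (homTensor_lcomp R S ω (P.d (i + 1)) t).symm)
      (hF.exact ((P.isExtAcyclic_iff (T' := Sᵐᵒᵖ) ω).1 h i))

theorem unitMap_bijective_of_isFlat (P : ProjRes R ω) [P.DegreewiseFinite]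
    (h : Function.Bijective (fun s : S => rightMul R S ω s)) (hF : IsFlat S F) :
    Function.Bijective (unitMap R S ω F) := by
  have : FaithfulSMul Sᵐᵒᵖ ω := ⟨fun {s t} hst =>
    MulOpposite.unop_injective (h.1 (LinearMap.ext hst))⟩
  have hex : Function.Exact (LinearMap.toSpanSingleton Sᵐᵒᵖ (P.P 0 →ₗ[R] ω) P.ε)
      (LinearMap.lcomp Sᵐᵒᵖ ω (P.d 0)) := P.exact_toSpanSingleton_ε fun f => by
    obtain ⟨s, hs⟩ := h.2 f
    exact ⟨MulOpposite.op s, LinearMap.congr_fun hs⟩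
  exact AddMonoidHom.bijective_of_bijective_of_injective_of_left_exact
    (tmulLeft S F P.ε) (rTensor S F (LinearMap.lcomp Sᵐᵒᵖ ω (P.d 0)))
    (LinearMap.lcomp ℤ (BTensor S ω F) P.ε).toAddMonoidHom
    (LinearMap.lcomp ℤ (BTensor S ω F) (P.d 0)).toAddMonoidHom
    (unitMap R S ω F).toAddMonoidHom (homTensor R S ω (P.P 0) F) (homTensor R S ω (P.P 1) F)
    rfl (AddMonoidHom.ext fun t => (homTensor_lcomp R S ω (P.d 0) t).symm)
    (hF.tmulLeft_exact hex) (lcomp_exact_of_surjective P.exact_zero P.surjective)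
    (homTensor_bijective R S ω) (homTensor_bijective R S ω).1
    (hF.tmulLeft_injective P.toSpanSingleton_ε_injective)
    fun f g hfg => (LinearMap.cancel_right P.surjective).1 hfg

end Flat

section Injective

variable {X I : Type u} [AddCommGroup X] [Module Sᵐᵒᵖ X] [AddCommGroup I] [Module R I]
  [Module.Injective R I]

theorem ProjRes.torVanishes_homFrom_of_injective (Q : ProjRes Sᵐᵒᵖ X) [Q.DegreewiseFinite]
    (h : IsExtAcyclic (ModuleCat.of Sᵐᵒᵖ X) (ModuleCat.of Sᵐᵒᵖ ω)) (i : ℕ) :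
    Q.TorVanishes i (HomFrom R S ω I) := by
  have := SMulCommClass.symm R Sᵐᵒᵖ ω
  let e (j : ℕ) := AddEquiv.ofBijective _ (tensorHom_bijective R S ω (P := Q.P j) (I := I))
  let δ (j : ℕ) := (LinearMap.lcomp ℤ I (LinearMap.lcomp R ω (Q.d j))).toAddMonoidHom
  exact (Function.Exact.iff_of_ladder_addEquiv (g₁₂ := δ (i + 1)) (g₂₃ := δ i)
    (e (i + 2)) (e (i + 1)) (e i)
    (AddMonoidHom.ext fun t => (tensorHom_rTensor R S ω (Q.d (i + 1)) t).symm)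
    (AddMonoidHom.ext fun t => (tensorHom_rTensor R S ω (Q.d i) t).symm)).1
    (lcomp_exact_of_injective (T' := ℤ) ((Q.isExtAcyclic_iff (T' := R) ω).1 h i))

theorem counitMap_bijective_of_injective (Q : ProjRes Sᵐᵒᵖ ω) [Q.DegreewiseFinite]
    (h : Function.Bijective (fun r : R => Module.toModuleEnd Sᵐᵒᵖ ω r)) :
    Function.Bijective (counitMap R S ω I) := by
  have := SMulCommClass.symm R Sᵐᵒᵖ ω
  have : FaithfulSMul R ω := ⟨fun hrt => h.1 (LinearMap.ext hrt)⟩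
  have hex : Function.Exact (LinearMap.toSpanSingleton R (Q.P 0 →ₗ[Sᵐᵒᵖ] ω) Q.ε)
      (LinearMap.lcomp R ω (Q.d 0)) := Q.exact_toSpanSingleton_ε fun f => by
    obtain ⟨r, hr⟩ := h.2 f
    exact ⟨r, LinearMap.congr_fun hr⟩
  exact AddMonoidHom.bijective_of_surjective_of_bijective_of_right_exact
    (rTensor S (HomFrom R S ω I) (Q.d 0)) (rTensor S (HomFrom R S ω I) Q.ε)
    (LinearMap.lcomp ℤ I (LinearMap.lcomp R ω (Q.d 0))).toAddMonoidHom
    (LinearMap.applyₗ' ℤ Q.ε).toAddMonoidHom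
    (tensorHom R S ω (Q.P 1) I) (tensorHom R S ω (Q.P 0) I) (counitMap R S ω I).toAddMonoidHom
    (AddMonoidHom.ext fun t => (tensorHom_rTensor R S ω (Q.d 0) t).symm)
    (AddMonoidHom.ext fun t => (counitMap_rTensor R S ω Q.ε t).symm)
    (BTensor.rTensor_exact S Q.exact_zero Q.surjective) (lcomp_apply_exact_of_injective hex)
    (tensorHom_bijective R S ω).2 (tensorHom_bijective R S ω)
    (rTensor_surjective S Q.surjective)
    (apply_surjective_of_injective Q.toSpanSingleton_ε_injective)

end Injective

namespace IsSemidualizing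

variable (hω : IsSemidualizing R S ω)
include hω

theorem isExtAcyclic_tensor {F : Type u} [AddCommGroup F] [Module S F] (hF : IsFlat S F) :
    IsExtAcyclic (ModuleCat.of R ω) (ModuleCat.of R (BTensor S ω F)) := by
  obtain ⟨P, _⟩ := hω.finite_res_left.exists_projRes
  exact .tensor_of_isFlat P hω.ext_left hF

theorem unitMap_bijective {F : Type u} [AddCommGroup F] [Module S F] (hF : IsFlat S F) :
    Function.Bijective (unitMap R S ω F) := by
  obtain ⟨P, _⟩ := hω.finite_res_left.exists_projRes
  exact unitMap_bijective_of_isFlat P hω.homothety_right hF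

theorem counitMap_bijective (I : Type u) [AddCommGroup I] [Module R I] [Module.Injective R I] :
    Function.Bijective (counitMap R S ω I) := by
  obtain ⟨Q, _⟩ := hω.finite_res_right.exists_projRes
  exact counitMap_bijective_of_injective Q hω.homothety_left

end IsSemidualizing

end Bimodule

/-! ### Transport of resolutions -/

section Functors

variable (R S : Type u) [Ring R] [Ring S] (ω : Type u) [AddCommGroup ω] [Module R ω]
  [Module Sᵐᵒᵖ ω] [SMulCommClass R Sᵐᵒᵖ ω]
  {A B C : Type u} [AddCommGroup A] [Module R A] [AddCommGroup B] [Module R B]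
  [AddCommGroup C] [Module R C] {f : A →ₗ[R] B} {g : B →ₗ[R] C}

theorem HomFrom.map_injective (hf : Function.Injective f) :
    Function.Injective (HomFrom.map R S ω f) := fun _ _ h =>
  (LinearMap.cancel_left hf).1 h

theorem HomFrom.map_exact (hf : Function.Injective f) (hfg : Function.Exact f g) :
    Function.Exact (HomFrom.map R S ω f) (HomFrom.map R S ω g) := by
  refine fun h => ⟨fun hh => ?_, ?_⟩
  · have hrange (x : ω) : h.hom x ∈ LinearMap.range f := (hfg _).1 (LinearMap.congr_fun hh x)
    let e := LinearEquiv.ofInjective f hf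
    exact ⟨e.symm.toLinearMap.comp (h.hom.codRestrict _ hrange),
      LinearMap.ext fun x => congrArg Subtype.val (e.apply_symm_apply ⟨h.hom x, hrange x⟩)⟩
  · rintro ⟨k, rfl⟩
    exact LinearMap.ext fun x => hfg.apply_apply_eq_zero _

theorem HomFrom.map_surjective_of_subsingleton_ext {A B C : ModuleCat.{u} R} {f : A →ₗ[R] B}
    {g : B →ₗ[R] C} (hf : Function.Injective f) (hfg : Function.Exact f g)
    (hg : Function.Surjective g) [Subsingleton (Abelian.Ext (ModuleCat.of R ω) A 1)] :
    Function.Surjective (HomFrom.map R S ω g) := fun c =>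
  exists_lift_of_subsingleton_ext (X := ModuleCat.of R ω) hf hfg hg c

/-- The isomorphism `A_* ≃ B_*` induced by an isomorphism `A ≃ B`. -/
def HomFrom.congr (e : A ≃ₗ[R] B) : HomFrom R S ω A ≃ₗ[S] HomFrom R S ω B :=
  .ofLinearMap (HomFrom.map R S ω e.toLinearMap) (HomFrom.map R S ω e.symm.toLinearMap)
    (LinearMap.ext fun _ => LinearMap.ext fun _ => e.apply_symm_apply _)
    (LinearMap.ext fun _ => LinearMap.ext fun _ => e.symm_apply_apply _)

/-- The isomorphism `ω ⊗ N ≃ ω ⊗ N'` induced by an isomorphism `N ≃ N'`. -/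
def tensorCongr {N N' : Type u} [AddCommGroup N] [Module S N] [AddCommGroup N'] [Module S N']
    (e : N ≃ₗ[S] N') : BTensor S ω N ≃ₗ[R] BTensor S ω N' :=
  .ofBijective (lTensor S ω R e.toLinearMap) (lCongr S ω e).bijective

end Functors

section Transport

variable {R S : Type u} [Ring R] [Ring S] {ω : Type u} [AddCommGroup ω] [Module R ω]
  [Module Sᵐᵒᵖ ω] [SMulCommClass R Sᵐᵒᵖ ω] {𝒳 : ModuleCat.{u} R → Prop}
  {𝒴 : ModuleCat.{u} S → Prop} {M : ModuleCat.{u} R} {N : ModuleCat.{u} S} {n : ℕ}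

theorem HasResolution.isExtAcyclic {X : ModuleCat.{u} R} (h𝒳 : ∀ Y, 𝒳 Y → IsExtAcyclic X Y)
    (h : HasResolution 𝒳 M n) : IsExtAcyclic X M := by
  induction n generalizing M with
  | zero =>
    obtain ⟨Y, hY, ⟨e⟩⟩ := hasResolution_zero_iff.1 h
    exact (h𝒳 Y hY).of_linearEquiv e
  | succ n ih =>
    obtain ⟨K, Y, f, g, hY, hK, hf, hfg, hg⟩ := hasResolution_succ_iff.1 h
    exact .of_exact hf hfg hg (ih hK) (h𝒳 Y hY)

theorem HasResolution.homFrom (h𝒳 : ∀ X, 𝒳 X → IsExtAcyclic (ModuleCat.of R ω) X)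
    (h𝒴 : ∀ X, 𝒳 X → 𝒴 (ModuleCat.of S (HomFrom R S ω X))) (h : HasResolution 𝒳 M n) :
    HasResolution 𝒴 (ModuleCat.of S (HomFrom R S ω M)) n := by
  induction n generalizing M with
  | zero =>
    obtain ⟨X, hX, ⟨e⟩⟩ := hasResolution_zero_iff.1 h
    exact hasResolution_zero_iff.2 ⟨_, h𝒴 X hX, ⟨HomFrom.congr R S ω e⟩⟩
  | succ n ih =>
    obtain ⟨K, X, f, g, hX, hK, hf, hfg, hg⟩ := hasResolution_succ_iff.1 h
    have := hK.isExtAcyclic h𝒳 1 le_rfl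
    exact hasResolution_succ_iff.2 ⟨_, _, HomFrom.map R S ω f, HomFrom.map R S ω g, h𝒴 X hX, ih hK,
      HomFrom.map_injective R S ω hf, HomFrom.map_exact R S ω hf hfg,
      HomFrom.map_surjective_of_subsingleton_ext R S ω hf hfg hg⟩

theorem HasCoresolution.homFrom (h𝒳 : ∀ X, 𝒳 X → IsExtAcyclic (ModuleCat.of R ω) X)
    (h𝒴 : ∀ X, 𝒳 X → 𝒴 (ModuleCat.of S (HomFrom R S ω X)))
    (hM : IsExtAcyclic (ModuleCat.of R ω) M) (h : HasCoresolution 𝒳 M n) :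
    HasCoresolution 𝒴 (ModuleCat.of S (HomFrom R S ω M)) n := by
  induction n generalizing M with
  | zero =>
    obtain ⟨X, hX, ⟨e⟩⟩ := hasCoresolution_zero_iff.1 h
    exact hasCoresolution_zero_iff.2 ⟨_, h𝒴 X hX, ⟨HomFrom.congr R S ω e⟩⟩
  | succ n ih =>
    obtain ⟨X, K, f, g, hX, hK, hf, hfg, hg⟩ := hasCoresolution_succ_iff.1 h
    have := hM 1 le_rfl
    exact hasCoresolution_succ_iff.2 ⟨_, _, HomFrom.map R S ω f, HomFrom.map R S ω g, h𝒴 X hX,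
      ih (.of_exact hf hfg hg hM (h𝒳 X hX)) hK, HomFrom.map_injective R S ω hf,
      HomFrom.map_exact R S ω hf hfg, HomFrom.map_surjective_of_subsingleton_ext R S ω hf hfg hg⟩

variable {Q : ProjRes Sᵐᵒᵖ ω}

theorem HasResolution.tensor (h𝒴 : ∀ Y, 𝒴 Y → ∀ i, Q.TorVanishes i Y)
    (h𝒳 : ∀ Y, 𝒴 Y → 𝒳 (ModuleCat.of R (BTensor S ω Y))) (hN : ∀ i, Q.TorVanishes i N)
    (h : HasResolution 𝒴 N n) : HasResolution 𝒳 (ModuleCat.of R (BTensor S ω N)) n := by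
  induction n generalizing N with
  | zero =>
    obtain ⟨Y, hY, ⟨e⟩⟩ := hasResolution_zero_iff.1 h
    exact hasResolution_zero_iff.2 ⟨_, h𝒳 Y hY, ⟨tensorCongr R S ω e⟩⟩
  | succ n ih =>
    obtain ⟨K, Y, f, g, hY, hK, hf, hfg, hg⟩ := hasResolution_succ_iff.1 h
    exact hasResolution_succ_iff.2 ⟨_, _, lTensor S ω R f, lTensor S ω R g, h𝒳 Y hY,
      ih (fun i => .of_exact hf hfg hg (h𝒴 Y hY i) (hN (i + 1))) hK,
      (hN 0).lMap_injective hf hfg hg, lMap_exact S hfg hg, lMap_surjective S hg⟩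

theorem HasCoresolution.torVanishes (h𝒴 : ∀ Y, 𝒴 Y → ∀ i, Q.TorVanishes i Y)
    (h : HasCoresolution 𝒴 N n) (i : ℕ) : Q.TorVanishes i N := by
  induction n generalizing N i with
  | zero =>
    obtain ⟨Y, hY, ⟨e⟩⟩ := hasCoresolution_zero_iff.1 h
    exact (h𝒴 Y hY i).of_equiv e
  | succ n ih =>
    obtain ⟨Y, K, f, g, hY, hK, hf, hfg, hg⟩ := hasCoresolution_succ_iff.1 h
    exact .of_exact hf hfg hg (h𝒴 Y hY i) (ih hK (i + 1))

theorem HasCoresolution.tensor (h𝒴 : ∀ Y, 𝒴 Y → ∀ i, Q.TorVanishes i Y)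
    (h𝒳 : ∀ Y, 𝒴 Y → 𝒳 (ModuleCat.of R (BTensor S ω Y))) (h : HasCoresolution 𝒴 N n) :
    HasCoresolution 𝒳 (ModuleCat.of R (BTensor S ω N)) n := by
  induction n generalizing N with
  | zero =>
    obtain ⟨Y, hY, ⟨e⟩⟩ := hasCoresolution_zero_iff.1 h
    exact hasCoresolution_zero_iff.2 ⟨_, h𝒳 Y hY, ⟨tensorCongr R S ω e⟩⟩
  | succ n ih =>
    obtain ⟨Y, K, f, g, hY, hK, hf, hfg, hg⟩ := hasCoresolution_succ_iff.1 h
    exact hasCoresolution_succ_iff.2 ⟨_, _, lTensor S ω R f, lTensor S ω R g, h𝒳 Y hY, ih hK,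
      (hK.torVanishes h𝒴 0).lMap_injective hf hfg hg, lMap_exact S hfg hg, lMap_surjective S hg⟩

end Transport

namespace ProjRes

variable {S : Type u} [Ring S] {X : Type u} [AddCommGroup X] [Module Sᵐᵒᵖ X] {Q : ProjRes Sᵐᵒᵖ X}
  {A B C : Type u} [AddCommGroup A] [Module S A] [AddCommGroup B] [Module S B]
  [AddCommGroup C] [Module S C] {f : A →ₗ[S] B} {g : B →ₗ[S] C}

theorem TorVanishes.range {i : ℕ} (hC : Q.TorVanishes i C)
    (hg : Q.TorVanishes (i + 1) (C ⧸ LinearMap.range g)) :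
    Q.TorVanishes i (LinearMap.range g) :=
  .of_exact (Submodule.subtype_injective _) (LinearMap.exact_subtype_mkQ _)
    (Submodule.mkQ_surjective _) hC hg

theorem TorVanishes.of_left_exact {i : ℕ} (hf : Function.Injective f) (hfg : Function.Exact f g)
    (hB : Q.TorVanishes i B) (hC : Q.TorVanishes (i + 1) C)
    (hg : Q.TorVanishes (i + 2) (C ⧸ LinearMap.range g)) : Q.TorVanishes i A :=
  .of_exact hf (exact_rangeRestrict hfg) g.surjective_rangeRestrict hB (hC.range hg)

theorem lMap_injective_of_left_exact (hf : Function.Injective f) (hfg : Function.Exact f g)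
    (hC : Q.TorVanishes 0 C) (hg : Q.TorVanishes 1 (C ⧸ LinearMap.range g)) :
    Function.Injective (lMap S X f) :=
  (hC.range hg).lMap_injective hf (exact_rangeRestrict hfg) g.surjective_rangeRestrict

theorem lMap_exact_of_torVanishes_quotient_range (hfg : Function.Exact f g)
    (hg : Q.TorVanishes 0 (C ⧸ LinearMap.range g)) :
    Function.Exact (lMap S X f) (lMap S X g) := by
  have hι : Function.Injective (lMap S X (LinearMap.range g).subtype) :=
    hg.lMap_injective (Submodule.subtype_injective _) (LinearMap.exact_subtype_mkQ _)
      (Submodule.mkQ_surjective _)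
  have hcomp : lMap S X g = lMap S X (LinearMap.range g).subtype ∘ lMap S X g.rangeRestrict :=
    funext fun t => by
      rw [Function.comp_apply, lMap_lMap, LinearMap.subtype_comp_codRestrict]
  rw [hcomp]
  exact (lMap_exact S (exact_rangeRestrict hfg) g.surjective_rangeRestrict).comp_injective _ hι
    (map_zero _)

end ProjRes

section Comparison

variable {R S : Type u} [Ring R] [Ring S] {ω : Type u} [AddCommGroup ω] [Module R ω]
  [Module Sᵐᵒᵖ ω] [SMulCommClass R Sᵐᵒᵖ ω] {M : ModuleCat.{u} R} {N : ModuleCat.{u} S}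
  {𝒳 : ModuleCat.{u} S → Prop}

theorem IsInftyCotorsionfree.torVanishes (hM : IsInftyCotorsionfree R S ω M)
    (hω : IsSemidualizing R S ω) (Q : ProjRes Sᵐᵒᵖ ω) [Q.DegreewiseFinite] (i : ℕ) :
    Q.TorVanishes i (ModuleCat.of S (HomFrom R S ω M)) := by
  obtain ⟨I₀, I₁, η, f, hmin, htor⟩ := hM (i + 3)
  have := hmin.injective_zero
  have := hmin.injective_one
  exact .of_left_exact (HomFrom.map_injective R S ω hmin.mono)
    (HomFrom.map_exact R S ω hmin.mono hmin.exact)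
    (Q.torVanishes_homFrom_of_injective hω.ext_right i)
    (Q.torVanishes_homFrom_of_injective hω.ext_right (i + 1))
    (Q.torVanishes_of_isZero_tor (N := cokerStar R S ω f) (htor (i + 3) (by omega) le_rfl))

theorem IsInftyCotorsionfree.counitMap_bijective (hM : IsInftyCotorsionfree R S ω M)
    (hω : IsSemidualizing R S ω) : Function.Bijective (counitMap R S ω M) := by
  obtain ⟨Q, _⟩ := hω.finite_res_right.exists_projRes
  obtain ⟨I₀, I₁, η, f, hmin, htor⟩ := hM 2
  have := hmin.injective_zero
  have := hmin.injective_one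
  have hη := HomFrom.map_injective R S ω hmin.mono
  have hηf := HomFrom.map_exact R S ω hmin.mono hmin.exact
  exact AddMonoidHom.bijective_of_bijective_of_injective_of_left_exact
    (lMap S ω (HomFrom.map R S ω η)) (lMap S ω (HomFrom.map R S ω f))
    η.toAddMonoidHom f.toAddMonoidHom (counitMap R S ω M).toAddMonoidHom
    (counitMap R S ω I₀).toAddMonoidHom (counitMap R S ω I₁).toAddMonoidHom
    (AddMonoidHom.ext fun t => (counitMap_naturality R S ω η t).symm)
    (AddMonoidHom.ext fun t => (counitMap_naturality R S ω f t).symm)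
    (ProjRes.lMap_exact_of_torVanishes_quotient_range hηf
      (Q.torVanishes_of_isZero_tor (N := cokerStar R S ω f) (htor 1 le_rfl one_le_two)))
    hmin.exact (hω.counitMap_bijective I₀) (hω.counitMap_bijective I₁).1
    (ProjRes.lMap_injective_of_left_exact hη hηf
      (Q.torVanishes_homFrom_of_injective hω.ext_right 0)
      (Q.torVanishes_of_isZero_tor (N := cokerStar R S ω f) (htor 2 one_le_two le_rfl)))
    hmin.mono

/-- The class of modules isomorphic to `ω ⊗_S F` with `F` in `𝒳`, the common form of `𝓕_ω(R)` and
`𝓟_ω(R)`. -/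
def TensorClass (R : Type u) {S : Type u} [Ring R] [Ring S] (ω : Type u) [AddCommGroup ω]
    [Module R ω] [Module Sᵐᵒᵖ ω] [SMulCommClass R Sᵐᵒᵖ ω] (𝒳 : ModuleCat.{u} S → Prop)
    (M : ModuleCat.{u} R) : Prop :=
  ∃ F : ModuleCat.{u} S, 𝒳 F ∧ Nonempty (M ≃ₗ[R] BTensor S ω F)

theorem relProjDim_homFrom_le (hω : IsSemidualizing R S ω) (h𝒳 : ∀ F, 𝒳 F → IsFlat S F)
    (h𝒳' : ∀ F F' : ModuleCat.{u} S, (F ≃ₗ[S] F') → 𝒳 F → 𝒳 F') (M : ModuleCat.{u} R) :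
    relProjDim 𝒳 (ModuleCat.of S (HomFrom R S ω M)) ≤ relProjDim (TensorClass R ω 𝒳) M := by
  refine relProjDim_le_of_forall fun n hn => hn.homFrom ?_ ?_
  · rintro X ⟨F, hF, ⟨e⟩⟩
    exact (hω.isExtAcyclic_tensor (h𝒳 F hF)).of_linearEquiv e.symm
  · rintro X ⟨F, hF, ⟨e⟩⟩
    exact h𝒳' F _ ((LinearEquiv.ofBijective _ (hω.unitMap_bijective (h𝒳 F hF))).trans
      (HomFrom.congr R S ω e.symm)) hF

theorem relProjDim_homFrom_eq (hω : IsSemidualizing R S ω) (h𝒳 : ∀ F, 𝒳 F → IsFlat S F)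
    (h𝒳' : ∀ F F' : ModuleCat.{u} S, (F ≃ₗ[S] F') → 𝒳 F → 𝒳 F')
    (hM : IsInftyCotorsionfree R S ω M) :
    relProjDim 𝒳 (ModuleCat.of S (HomFrom R S ω M)) = relProjDim (TensorClass R ω 𝒳) M := by
  obtain ⟨Q, _⟩ := hω.finite_res_right.exists_projRes
  refine (relProjDim_homFrom_le hω h𝒳 h𝒳' M).antisymm (relProjDim_le_of_forall fun n hn => ?_)
  exact (hn.tensor (fun F hF i => Q.torVanishes_of_isFlat i (h𝒳 F hF))
    (fun F hF => ⟨F, hF, ⟨LinearEquiv.refl R _⟩⟩) (hM.torVanishes hω Q)).of_equiv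
    (LinearEquiv.ofBijective _ (hM.counitMap_bijective hω))

theorem injective_tensor_of_isOmegaInjective (hω : IsSemidualizing R S ω)
    (hN : IsOmegaInjective R S ω N) : Module.Injective R (BTensor S ω N) := by
  obtain ⟨I, hI, ⟨e⟩⟩ := hN
  let e' : BTensor S ω N ≃ₗ[R] I := (tensorCongr R S ω e).trans
    (LinearEquiv.ofBijective _ (hω.counitMap_bijective I))
  exact (Module.injective_iff_injective_object R _).2 <|
    Injective.of_iso e'.symm.toModuleIso ((Module.injective_iff_injective_object R I).1 hI)

theorem injDim_tensor_le (hω : IsSemidualizing R S ω) (N : ModuleCat.{u} S) :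
    injDim (ModuleCat.of R (BTensor S ω N)) ≤ relInjDim (IsOmegaInjective R S ω) N := by
  obtain ⟨Q, _⟩ := hω.finite_res_right.exists_projRes
  rw [injDim_eq_relInjDim]
  refine relInjDim_le_of_forall fun n hn =>
    hn.tensor (Q := Q) ?_ fun _ => injective_tensor_of_isOmegaInjective hω
  rintro N ⟨I, hI, ⟨e⟩⟩ i
  have : Module.Injective R I := hI
  exact (Q.torVanishes_homFrom_of_injective hω.ext_right i).of_equiv e.symm

theorem injDim_tensor_eq (hω : IsSemidualizing R S ω)
    (hext : IsExtAcyclic (ModuleCat.of R ω) (ModuleCat.of R (BTensor S ω N)))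
    (hunit : Function.Bijective (unitMap R S ω N)) :
    injDim (ModuleCat.of R (BTensor S ω N)) = relInjDim (IsOmegaInjective R S ω) N := by
  refine (injDim_tensor_le hω N).antisymm ?_
  rw [injDim_eq_relInjDim]
  exact relInjDim_le_of_forall fun n hn =>
    (hn.homFrom (fun I (_ : Module.Injective R I) => .of_injective _ I)
      (fun I hI => ⟨I, hI, ⟨LinearEquiv.refl S _⟩⟩) hext).of_equiv
    (LinearEquiv.ofBijective _ hunit).symm

end Comparison

end SemiDual

end

theorem theorem3p5_general (R S : Type u) [Ring R] [Ring S] (ω : Type u) [AddCommGroup ω]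
    [Module R ω] [Module Sᵐᵒᵖ ω] [SMulCommClass R Sᵐᵒᵖ ω] (hω : SemiDual.IsSemidualizing R S ω) :
    (∀ M : ModuleCat.{u} R,
      SemiDual.flatDim (ModuleCat.of S (SemiDual.HomFrom R S ω M)) ≤
        SemiDual.relProjDim (SemiDual.IsOmegaFlat R S ω) M ∧
      (SemiDual.IsInftyCotorsionfree R S ω M →
        SemiDual.flatDim (ModuleCat.of S (SemiDual.HomFrom R S ω M)) =
          SemiDual.relProjDim (SemiDual.IsOmegaFlat R S ω) M)) ∧
    (∀ M : ModuleCat.{u} R,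
      SemiDual.projDim (ModuleCat.of S (SemiDual.HomFrom R S ω M)) ≤
        SemiDual.relProjDim (SemiDual.IsOmegaProjective R S ω) M ∧
      (SemiDual.IsInftyCotorsionfree R S ω M →
        SemiDual.projDim (ModuleCat.of S (SemiDual.HomFrom R S ω M)) =
          SemiDual.relProjDim (SemiDual.IsOmegaProjective R S ω) M)) ∧
    (∀ N : ModuleCat.{u} S,
      SemiDual.injDim (ModuleCat.of R (SemiDual.BTensor S ω N)) ≤
        SemiDual.relInjDim (SemiDual.IsOmegaInjective R S ω) N ∧
      (SemiDual.IsExtAcyclic (ModuleCat.of R ω) (ModuleCat.of R (SemiDual.BTensor S ω N)) →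
        Function.Bijective (SemiDual.unitMap R S ω N) →
        SemiDual.injDim (ModuleCat.of R (SemiDual.BTensor S ω N)) =
          SemiDual.relInjDim (SemiDual.IsOmegaInjective R S ω) N)) := by
  have isFlat_of_equiv (F F' : ModuleCat.{u} S) (e : F ≃ₗ[S] F') (hF : SemiDual.IsFlat S F) :
      SemiDual.IsFlat S F' := hF.of_equiv e
  have projective_of_equiv (P P' : ModuleCat.{u} S) (e : P ≃ₗ[S] P')
      (_ : Module.Projective S P) : Module.Projective S P' := .of_equiv' e
  have isFlat_of_projective (P : ModuleCat.{u} S) (_ : Module.Projective S P) :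
      SemiDual.IsFlat S P := .of_projective P
  refine ⟨fun M => ⟨?_, fun hM => ?_⟩, fun M => ?_, fun N => ?_⟩
  · exact SemiDual.relProjDim_homFrom_le hω (fun _ h => h) isFlat_of_equiv M
  · exact SemiDual.relProjDim_homFrom_eq hω (fun _ h => h) isFlat_of_equiv hM
  · rw [SemiDual.projDim_eq_relProjDim]
    exact ⟨SemiDual.relProjDim_homFrom_le hω isFlat_of_projective projective_of_equiv M,
      SemiDual.relProjDim_homFrom_eq hω isFlat_of_projective projective_of_equiv⟩
  · exact ⟨SemiDual.injDim_tensor_le hω N, SemiDual.injDim_tensor_eq hω⟩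

theorem theorem3p5 (R S : Type u) [Ring R] [Ring S] (ω : Type u) [AddCommGroup ω] [Module R ω]
    [Module Sᵐᵒᵖ ω] [SMulCommClass R Sᵐᵒᵖ ω] (hω : SemiDual.IsSemidualizing R S ω) :
    (∀ M : ModuleCat.{u} R,
      SemiDual.flatDim (ModuleCat.of S (SemiDual.HomFrom R S ω M)) ≤
        SemiDual.relProjDim (SemiDual.IsOmegaFlat R S ω) M ∧
      (SemiDual.IsInftyCotorsionfree R S ω M →
        SemiDual.flatDim (ModuleCat.of S (SemiDual.HomFrom R S ω M)) =
          SemiDual.relProjDim (SemiDual.IsOmegaFlat R S ω) M)) ∧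
    (∀ M : ModuleCat.{u} R,
      SemiDual.projDim (ModuleCat.of S (SemiDual.HomFrom R S ω M)) ≤
        SemiDual.relProjDim (SemiDual.IsOmegaProjective R S ω) M ∧
      (SemiDual.IsInftyCotorsionfree R S ω M →
        SemiDual.projDim (ModuleCat.of S (SemiDual.HomFrom R S ω M)) =
          SemiDual.relProjDim (SemiDual.IsOmegaProjective R S ω) M)) ∧
    (∀ N : ModuleCat.{u} S,
      SemiDual.injDim (ModuleCat.of R (SemiDual.BTensor S ω N)) ≤
        SemiDual.relInjDim (SemiDual.IsOmegaInjective R S ω) N ∧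
      (SemiDual.InAuslanderClass R S ω N →
        SemiDual.injDim (ModuleCat.of R (SemiDual.BTensor S ω N)) =
          SemiDual.relInjDim (SemiDual.IsOmegaInjective R S ω) N)) :=
  have h := theorem3p5_general R S ω hω
  ⟨h.1, h.2.1, fun N => ⟨(h.2.2 N).1, fun hN => (h.2.2 N).2 hN.ext_zero hN.unit_bijective⟩⟩
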